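/- Let $Q$ be a smooth $n$-dimensional manifold and let $\Delta\subset TQ$ be a regular (smooth) distribution of codimension $k$ on $Q$: near every point of $Q$ it is the common kernel of $k$ pointwise linearly independent smooth one-forms $\Phi^1,\dots,\Phi^k$, $\Phi^a=\Phi^a_i\,\mathrm dq^i$. Let $L:TQ\times\mathbb R\to\mathbb R$ be a smooth function which is regular: in the natural coordinates $(q^i,\dot q^i,z)$ induced by any chart of $Q$, the matrix $\left(\partial^2L/\partial\dot q^i\partial\dot q^j\right)$ is invertible everywhere. Let $S$ be the canonical vertical endomorphism and $\mathcal D=\dot q^i\,\partial/\partial\dot q^i$ the Liouville vector field, both extended from $TQ$ to $TQ\times\mathbb R$ in the natural way; let $\eta_L=\mathrm dz-S^*(\mathrm dL)=\mathrm dz-\frac{\partial L}{\partial\dot q^i}\mathrm dq^i$ be the contact Lagrangian form, $E_L=\mathcal D(L)-L$ the energy, $\mathcal R_L$ the Reeb vector field (the unique vector field with $\iota_{\mathcal R_L}\mathrm d\eta_L=0$ and $\eta_L(\mathcal R_L)=1$), and $\flat_L(v)=\iota_v\,\mathrm d\eta_L+\eta_L(v)\,\eta_L$. Let $\Delta^l$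 be the distribution on $TQ\times\mathbb R$ whose annihilator $(\Delta^l)^\circ$ is the pull-back of the annihilator $\Delta^\circ\subset T^*Q$ of $\Delta$ by the projection $TQ\times\mathbb R\to Q$. Let $X$ be a smooth vector field on $TQ\times\mathbb R$ such that $$\flat_L(X)-\mathrm dE_L+\big(E_L+\mathcal R_L(E_L)\big)\eta_L\in(\Delta^l)^\circ\quad\text{on } TQ\times\mathbb R,$$ and such that $X$ is tangent to the submanifold $\Delta\times\mathbb R$ at each of its points. Then: (1) $X$ is a SODE on $TQ\times\mathbb R$, that is, $S(X)=\mathcal D$. (2) Every integral curve of $X$, defined on an open interval, has the form $(\xi,\dot\xi,z)$ with $\xi$ a smooth path in $Q$ and $z$ a smooth function such that $\dot z=L(\xi,\dot\xi,z)$, and for all independent local one-forms $\Phi^1,\dots,\Phi^k$ defining $\Delta$ on an open set there are Lagrange multipliers $\lambda_a$ (functions of the time, the same for all charts) such that, in the natural coordinates induced by any chart of $Q$, $$\frac{\mathrm d}{\mathrm dt}\frac{\partial L}{\partial\dot q^i}-\frac{\partial L}{\partial q^i}-\frac{\partial L}{\partial\dot q^i}\frac{\partial L}{\partial z}=\lambda_a\Phi^a_i$$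 along the curve. If moreover the integral curve meets $\Delta\times\mathbb R$, then it is contained in $\Delta\times\mathbb R$, and so it also satisfies $\Phi^a(\dot\xi(t))=0$ for all $a$: $\xi$ solves the constrained Herglotz equations. -/

import Mathlib

open scoped Manifold ContDiff

namespace ContactHerglotz

noncomputable section

/-! ### Differential calculus on manifolds -/

section Calculus

variable {F : Type*} [NormedAddCommGroup F] [NormedSpace ℝ F] {H : Type*} [TopologicalSpace H]
  {M : Type*} [TopologicalSpace M] [ChartedSpace H M]

/-- The differential `df` of a real function at `x`, as a covector. -/
def differential (J : ModelWithCorners ℝ F H) (f : M → ℝ) (x : M) : TangentSpace J x →L[ℝ] ℝ :=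
  mfderiv J 𝓘(ℝ, ℝ) f x

/-- The expression of a one-form in the chart around `x₀`: its pull-back by the inverse chart. -/
def formInChart (J : ModelWithCorners ℝ F H) (θ : (x : M) → TangentSpace J x →L[ℝ] ℝ) (x₀ : M) :
    F → (F →L[ℝ] ℝ) :=
  fun y => (θ ((extChartAt J x₀).symm y)).comp (mfderiv 𝓘(ℝ, F) J (extChartAt J x₀).symm y)

/-- The contraction `ι_u dθ` at `x` of the exterior derivative of a one-form `θ` on a manifold
without boundary, computed in the chart around `x`: with hats for the expressions in this chart,
`(ι_u dθ)(v) = (D_û θ̂)(v̂) - (D_v̂ θ̂)(û)`. -/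
def contrExtDeriv (J : ModelWithCorners ℝ F H) (θ : (x : M) → TangentSpace J x →L[ℝ] ℝ) (x : M)
    (u : TangentSpace J x) : TangentSpace J x →L[ℝ] ℝ :=
  let A : TangentSpace J x →L[ℝ] F := mfderiv J 𝓘(ℝ, F) (extChartAt J x) x
  let B : F →L[ℝ] F →L[ℝ] ℝ := fderiv ℝ (formInChart J θ x) (extChartAt J x x)
  (B (A u)).comp A - (B.flip (A u)).comp A

/-- The velocity of a curve in a manifold. -/
def velocity (J : ModelWithCorners ℝ F H) (ξ : ℝ → M) (t : ℝ) : TangentSpace J (ξ t) :=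
  mfderiv 𝓘(ℝ, ℝ) J ξ t (1 : ℝ)

/-- `w` is tangent at `x` to the subset `S`: it is the velocity of a smooth curve lying in `S`.
When `S` is an embedded submanifold and `x ∈ S`, these vectors form the tangent space of `S`. -/
def IsTangentTo (J : ModelWithCorners ℝ F H) (S : Set M) (x : M) (w : TangentSpace J x) : Prop :=
  ∃ c : ℝ → M, ContMDiffAt 𝓘(ℝ, ℝ) J ∞ c 0 ∧ (∀ᶠ t in nhds 0, c t ∈ S) ∧
    (⟨c 0, velocity J c 0⟩ : TangentBundle J M) = ⟨x, w⟩

end Calculus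

/-! ### The manifold `TQ × ℝ` -/

/-- The model space `ℝⁿ` of the configuration manifold. -/
abbrev Coord (n : ℕ) := EuclideanSpace ℝ (Fin n)

/-- The tangent space `T_qQ`. -/
abbrev TSpace (n : ℕ) {Q : Type*} [TopologicalSpace Q] [ChartedSpace (Coord n) Q] (q : Q) :=
  TangentSpace 𝓘(ℝ, Coord n) q

/-- The manifold `TQ × ℝ`. -/
abbrev Phase (n : ℕ) (Q : Type*) [TopologicalSpace Q] [ChartedSpace (Coord n) Q] :=
  TangentBundle 𝓘(ℝ, Coord n) Q × ℝ

/-- The model with corners of `TQ × ℝ` (there is no boundary). -/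
abbrev phaseModel (n : ℕ) := (𝓘(ℝ, Coord n).tangent).prod 𝓘(ℝ, ℝ)

variable {n k : ℕ} {Q : Type*} [TopologicalSpace Q] [ChartedSpace (Coord n) Q]
  [IsManifold 𝓘(ℝ, Coord n) ∞ Q]

/-- The tangent space `T_p(TQ × ℝ)`. -/
abbrev PSpace (p : Phase n Q) := TangentSpace (phaseModel n) p

/-- The projection `TQ × ℝ → Q`. -/
def proj (p : Phase n Q) : Q := p.1.1

/-- The tangent map of the projection `TQ × ℝ → Q`. -/
def tProj (p : Phase n Q) : PSpace p →L[ℝ] TSpace n p.1.1 :=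
  mfderiv (phaseModel n) 𝓘(ℝ, Coord n) proj p

/-- The vertical lift `T_qQ → T_p(TQ × ℝ)`, for `p = (v_q, z)`: the tangent map at `v_q` of the
inclusion `u ↦ (u, z)` of the fibre `T_qQ`. -/
def vertLift (p : Phase n Q) : TSpace n p.1.1 →L[ℝ] PSpace p :=
  mfderiv 𝓘(ℝ, Coord n) (phaseModel n)
    (fun u : Coord n => ((⟨p.1.1, u⟩, p.2) : Phase n Q)) p.1.2

/-- The vertical endomorphism `S`, extended from `TQ` to `TQ × ℝ`. -/
def vertEndo (p : Phase n Q) : PSpace p →L[ℝ] PSpace p := (vertLift p).comp (tProj p)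

/-- The Liouville vector field, extended from `TQ` to `TQ × ℝ`. -/
def liouville (p : Phase n Q) : PSpace p := vertLift p p.1.2

/-- A vector field `X` on `TQ × ℝ` is a SODE if `S(X)` is the Liouville vector field. -/
def IsSODE (X : (p : Phase n Q) → PSpace p) : Prop := ∀ p, vertEndo p (X p) = liouville p

/-! ### Coordinates -/

/-- The inverse of the natural coordinates `(qⁱ, q̇ⁱ)` on `TQ` induced by a chart of `Q`. -/
def natCoord (e : OpenPartialHomeomorph Q (Coord n)) (x v : Coord n) :
    TangentBundle 𝓘(ℝ, Coord n) Q :=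
  ⟨e.symm x, mfderiv 𝓘(ℝ, Coord n) 𝓘(ℝ, Coord n) e.symm x v⟩

/-- The expression `L(qⁱ, q̇ⁱ, z)` of a function on `TQ × ℝ` in natural coordinates. -/
def inCoord (L : Phase n Q → ℝ) (e : OpenPartialHomeomorph Q (Coord n)) (x v : Coord n) (z : ℝ) :
    ℝ := L (natCoord e x v, z)

/-- The `i`-th vector of the standard basis of `ℝⁿ`. -/
def basisVec (i : Fin n) : Coord n := EuclideanSpace.single i (1 : ℝ)

/-- `∂L/∂qⁱ` for a function of `(q, q̇, z)`. -/
def partialQ (l : Coord n → Coord n → ℝ → ℝ) (i : Fin n) (x v : Coord n) (z : ℝ) : ℝ :=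
  fderiv ℝ (fun x' => l x' v z) x (basisVec i)

/-- `∂L/∂q̇ⁱ` for a function of `(q, q̇, z)`. -/
def partialV (l : Coord n → Coord n → ℝ → ℝ) (i : Fin n) (x v : Coord n) (z : ℝ) : ℝ :=
  fderiv ℝ (fun v' => l x v' z) v (basisVec i)

/-- `∂L/∂z` for a function of `(q, q̇, z)`. -/
def partialZ (l : Coord n → Coord n → ℝ → ℝ) (x v : Coord n) (z : ℝ) : ℝ :=
  deriv (fun z' => l x v z') z

/-- The Hessian matrix `W_ij = ∂²L/∂q̇ⁱ∂q̇ʲ` with respect to the velocities. -/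
def velHessian (l : Coord n → Coord n → ℝ → ℝ) (x v : Coord n) (z : ℝ) :
    Matrix (Fin n) (Fin n) ℝ :=
  Matrix.of fun i j => partialV (partialV l j) i x v z

/-- `L` is a regular Lagrangian: in natural coordinates the Hessian matrix with respect to the
velocities is invertible. -/
def IsRegularLagrangian (L : Phase n Q → ℝ) : Prop :=
  ∀ e ∈ IsManifold.maximalAtlas 𝓘(ℝ, Coord n) ∞ Q, ∀ x ∈ e.target, ∀ v z,
    IsUnit (velHessian (inCoord L e) x v z)

/-! ### The contact structure of a Lagrangian -/

/-- The contact Lagrangian form `η_L = dz - S^*(dL)`. -/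
def contactForm (L : Phase n Q → ℝ) (p : Phase n Q) : PSpace p →L[ℝ] ℝ :=
  differential (phaseModel n) (fun p' : Phase n Q => p'.2) p -
    (differential (phaseModel n) L p).comp (vertEndo p)

/-- The energy `E_L`: the derivative of `L` along the Liouville vector field, minus `L`. -/
def energy (L : Phase n Q → ℝ) (p : Phase n Q) : ℝ :=
  differential (phaseModel n) L p (liouville p) - L p

/-- The map `♭_L(w) = ι_w dη_L + η_L(w) η_L`. -/
def flat (L : Phase n Q → ℝ) (p : Phase n Q) (w : PSpace p) : PSpace p →L[ℝ] ℝ :=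
  contrExtDeriv (phaseModel n) (contactForm L) p w + contactForm L p w • contactForm L p

/-- The Reeb vector field `R_L`: the vector field with `ι_R dη_L = 0` and `η_L(R) = 1`. It exists
and is unique when `L` is smooth and regular. -/
def reeb (L : Phase n Q → ℝ) (p : Phase n Q) : PSpace p :=
  Classical.epsilon fun R =>
    contrExtDeriv (phaseModel n) (contactForm L) p R = 0 ∧ contactForm L p R = 1

/-! ### Constraints -/

/-- `Φ¹, …, Φᵏ` are independent linear constraint functions for the distribution `D` on the open
set `U`: smooth one-forms (that is, smooth as fibrewise linear functions on `TU`), linearly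
independent at every point, whose common kernel is `D`. -/
structure IsConstraintFrame (D : (q : Q) → Submodule ℝ (TSpace n q)) (U : Set Q)
    (Φ : Fin k → (q : Q) → TSpace n q →L[ℝ] ℝ) : Prop where
  isOpen : IsOpen U
  smooth : ∀ a, ContMDiffOn 𝓘(ℝ, Coord n).tangent 𝓘(ℝ, ℝ) ∞
    (fun v : TangentBundle 𝓘(ℝ, Coord n) Q => Φ a v.1 v.2) {v | v.1 ∈ U}
  independent : ∀ q ∈ U, LinearIndependent ℝ fun a => Φ a q
  mem_iff : ∀ q ∈ U, ∀ v : TSpace n q, v ∈ D q ↔ ∀ a, Φ a q v = 0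

/-- `D` is a regular (smooth) distribution on `Q` of codimension `k`. -/
def IsRegularDistribution (k : ℕ) (D : (q : Q) → Submodule ℝ (TSpace n q)) : Prop :=
  ∀ q : Q, ∃ (U : Set Q) (Φ : Fin k → (q : Q) → TSpace n q →L[ℝ] ℝ),
    q ∈ U ∧ IsConstraintFrame D U Φ

/-- The subset `Δ × ℝ` of `TQ × ℝ`. -/
def constraintSet (D : (q : Q) → Submodule ℝ (TSpace n q)) : Set (Phase n Q) :=
  {p | p.1.2 ∈ D p.1.1}

/-- The annihilator of `Δ^l` at `p`: the pull-back to `TQ × ℝ` of the annihilator of `Δ`. -/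
def annLift (D : (q : Q) → Submodule ℝ (TSpace n q)) (p : Phase n Q) :
    Set (PSpace p →L[ℝ] ℝ) :=
  {θ | ∃ α : TSpace n p.1.1 →L[ℝ] ℝ, (∀ u ∈ D p.1.1, α u = 0) ∧ θ = α.comp (tProj p)}

/-- The component `Φ_i` of a one-form on `Q` in the coordinates given by a chart. -/
def formCoeff (Φ : (q : Q) → TSpace n q →L[ℝ] ℝ) (e : OpenPartialHomeomorph Q (Coord n))
    (i : Fin n) (x : Coord n) : ℝ :=
  Φ (natCoord e x (basisVec i)).1 (natCoord e x (basisVec i)).2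

/-- The tangent lift `(ξ, ξ̇)` of a curve on `Q`. -/
def tangentLift (ξ : ℝ → Q) (t : ℝ) : TangentBundle 𝓘(ℝ, Coord n) Q :=
  ⟨ξ t, velocity 𝓘(ℝ, Coord n) ξ t⟩

/-! ### The constrained Herglotz equations -/

/-- The dynamical part of the constrained Herglotz equations for a smooth path `ξ` and a function
`z` on `s`: one has `ż = L(ξ, ξ̇, z)` and, for all independent local constraint functions `Φᵃ`,
there are multipliers `lam a` such that, in all natural coordinates,
`d/dt (∂L/∂q̇ⁱ) = ∂L/∂qⁱ + ∂L/∂q̇ⁱ ∂L/∂z + ∑ₐ lam a Φᵃᵢ`, the left-hand side being the derivative of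
`∂L/∂q̇ⁱ` along the curve (so that it exists). As the `Φᵃ` are independent, the multipliers are
determined by the path, and they depend smoothly on time. -/
structure SolvesMultiplierEquations (k : ℕ) (L : Phase n Q → ℝ)
    (D : (q : Q) → Submodule ℝ (TSpace n q)) (s : Set ℝ) (ξ : ℝ → Q) (z : ℝ → ℝ) : Prop where
  smooth_path : ContMDiffOn 𝓘(ℝ, ℝ) 𝓘(ℝ, Coord n) ∞ ξ s
  smooth_action : ContDiffOn ℝ ∞ z s
  action : ∀ t ∈ s, HasDerivAt z (L (tangentLift ξ t, z t)) t
  multipliers : ∀ (U : Set Q) (Φ : Fin k → (q : Q) → TSpace n q →L[ℝ] ℝ),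
    IsConstraintFrame D U Φ → ∃ lam : Fin k → ℝ → ℝ,
      ∀ e ∈ IsManifold.maximalAtlas 𝓘(ℝ, Coord n) ∞ Q, ∀ t ∈ s, ξ t ∈ U → ξ t ∈ e.source →
        ∀ i : Fin n,
          HasDerivAt
            (fun τ => partialV (inCoord L e) i (e (ξ τ)) (deriv (fun r => e (ξ r)) τ) (z τ))
            (partialQ (inCoord L e) i (e (ξ t)) (deriv (fun r => e (ξ r)) t) (z t) +
              partialV (inCoord L e) i (e (ξ t)) (deriv (fun r => e (ξ r)) t) (z t) *
                partialZ (inCoord L e) (e (ξ t)) (deriv (fun r => e (ξ r)) t) (z t) +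
              ∑ a, lam a t * formCoeff (Φ a) e i (e (ξ t))) t

/-- The constrained Herglotz equations: the dynamical part with multipliers, together with the
constraints `Φᵃ(ξ̇) = 0`. -/
structure SolvesConstrainedHerglotz (k : ℕ) (L : Phase n Q → ℝ)
    (D : (q : Q) → Submodule ℝ (TSpace n q)) (s : Set ℝ) (ξ : ℝ → Q) (z : ℝ → ℝ) : Prop
    extends SolvesMultiplierEquations k L D s ξ z where
  constraint : ∀ (U : Set Q) (Φ : Fin k → (q : Q) → TSpace n q →L[ℝ] ℝ),
    IsConstraintFrame D U Φ → ∀ t ∈ s, ξ t ∈ U →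
      ∀ a, Φ a (ξ t) (velocity 𝓘(ℝ, Coord n) ξ t) = 0

end

end ContactHerglotz

open ContactHerglotz

open ContactHerglotz

/-! Write points as `(q, v, z)` in natural coordinates, `l` for the Lagrangian and `m = ∂l/∂v` for
the momentum covector. Then `η_L = dz - m·dq` and `dη_L(u, w) = -Dm(u)·w_q + Dm(w)·u_q`. Regularity
says that the vertical derivative `b ↦ Dm((0, b), 0)` is invertible. Therefore a Reeb vector exists,
and every such vector has `q`-part `0` and `z`-part `1`, whence `R_L(E_L) = -∂l/∂z`.

The dynamical equation is an identity of covectors with right-hand side `α ∘ T(proj)`, where `α`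
annihilates `Δ`. Testing it on three kinds of vectors gives everything in (1) and the dynamical part
of (2) (`coord_equations_of_flat_eq`). On vertical vectors it reads `Dm((0, b), 0)·(X_q - v) = 0`,
so `X_q = v`: the SODE property. On `∂/∂z` it gives `X_z = L`. On `q`-directions it is the Herglotz
equation with force `-α`. As `α` kills the common kernel of the `Φᵃ`, it is a combination of them,
and as it lives on `T_qQ` the coefficients are the same in all charts. To compute in natural
coordinates one needs chart independence of `dη_L`, which is
`contrExtDeriv_apply_of_parametrization`.

Invariance of `Δ × ℝ` is a Grönwall argument (`eventually_constraint_eq_zero`). Let `f = (Φᵃ(v))ₐ`.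
Tangency gives `Df(X) = 0` where `f = 0`. By independence of the `Φᵃ`, every nearby point can be
moved to a zero of `f` by a distance `O(‖f‖)`. Since `Df(X)` is locally Lipschitz, `‖(f ∘ γ)'‖ ≤ C
‖f ∘ γ‖` along an integral curve, so `f ∘ γ` vanishes near any time where it vanishes. The times
spent in `Δ × ℝ` form an open and relatively closed subset of the interval. -/

/-! ### Calculus in normed spaces: Grönwall, bootstrapping, pull-back of one-forms. -/

-- Grönwall's inequality in both time directions, each on a ball where the hypotheses hold.
open Filter Topology in
theorem eventually_eq_zero_of_norm_deriv_le {F : Type*} [NormedAddCommGroup F] [NormedSpace ℝ F]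
    {h h' : ℝ → F} {K t₀ : ℝ} (hd : ∀ᶠ t in 𝓝 t₀, HasDerivAt h (h' t) t)
    (hK : ∀ᶠ t in 𝓝 t₀, ‖h' t‖ ≤ K * ‖h t‖) (h0 : h t₀ = 0) : ∀ᶠ t in 𝓝 t₀, h t = 0 := by
  obtain ⟨ε, hε, H⟩ := Metric.eventually_nhds_iff_ball.1 (hd.and hK)
  refine Metric.eventually_nhds_iff_ball.2 ⟨ε, hε, fun t ht => ?_⟩
  rw [Metric.mem_ball, Real.dist_eq] at ht
  have hmem : ∀ x, |x - t₀| ≤ |t - t₀| → x ∈ Metric.ball t₀ ε := fun x hx => by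
    rw [Metric.mem_ball, Real.dist_eq]; exact hx.trans_lt ht
  rcases le_total t₀ t with hle | hle
  · have hm : ∀ x ∈ Set.Icc t₀ t, x ∈ Metric.ball t₀ ε := fun x hx => hmem x (by
      rw [abs_of_nonneg (sub_nonneg.2 hx.1), abs_of_nonneg (sub_nonneg.2 hle)]
      linarith [hx.2])
    exact eq_zero_of_abs_deriv_le_mul_abs_self_of_eq_zero_right
      (fun x hx => (H x (hm x hx)).1.continuousAt.continuousWithinAt)
      (fun x hx => (H x (hm x ⟨hx.1, hx.2.le⟩)).1.hasDerivWithinAt) h0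
      (fun x hx => (H x (hm x ⟨hx.1, hx.2.le⟩)).2) t ⟨hle, le_rfl⟩
  · have hm : ∀ x ∈ Set.Icc (-t₀) (-t), -x ∈ Metric.ball t₀ ε := fun x hx => hmem _ (by
      rw [abs_of_nonpos (by linarith [hx.1]), abs_of_nonpos (by linarith)]
      linarith [hx.2])
    -- Times before `t₀` are reached by running the curve backwards; the bound on the derivative is
    -- unchanged.
    have key := eq_zero_of_abs_deriv_le_mul_abs_self_of_eq_zero_right (f := fun x => h (-x))
      (f' := fun x => -h' (-x)) (K := K) (a := -t₀) (b := -t)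
      (fun x hx => ((H _ (hm x hx)).1.continuousAt.comp (x := x)
        continuous_neg.continuousAt).continuousWithinAt)
      (fun x hx => by
        simpa [Function.comp_def] using ((H _ (hm x ⟨hx.1, hx.2.le⟩)).1.scomp x (hasDerivAt_neg x)).hasDerivWithinAt)
      (by simpa using h0)
      (fun x hx => by simpa using (H _ (hm x ⟨hx.1, hx.2.le⟩)).2) (-t) ⟨by linarith, le_rfl⟩
    simpa using key

/-- Bootstrap: if `c` is `C^m`, so is its derivative `F ∘ c`, hence `c` is `C^(m+1)`. -/
theorem contDiffOn_of_hasDerivAt_comp {G : Type*} [NormedAddCommGroup G] [NormedSpace ℝ G]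
    {Ω : Set G} {F : G → G} (hF : ContDiffOn ℝ ∞ F Ω) {s : Set ℝ} (hs : IsOpen s) {c : ℝ → G}
    (hΩ : ∀ t ∈ s, c t ∈ Ω) (hc : ∀ t ∈ s, HasDerivAt c (F (c t)) t) : ContDiffOn ℝ ∞ c s := by
  refine contDiffOn_infty.2 fun m => ?_
  induction m with
  | zero =>
    exact contDiffOn_zero.2 fun t ht => (hc t ht).continuousAt.continuousWithinAt
  | succ m ih =>
    push_cast
    refine (contDiffOn_succ_iff_deriv_of_isOpen hs).2
      ⟨fun t ht => (hc t ht).differentiableAt.differentiableWithinAt, by simp, ?_⟩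
    exact ((hF.of_le (by exact_mod_cast le_top)).comp ih hΩ).congr fun t ht => (hc t ht).deriv

/-- The exterior derivative of a one-form on a vector space commutes with pull-backs. -/
theorem fderiv_pullback_antisymm {F G : Type*} [NormedAddCommGroup F] [NormedSpace ℝ F]
    [NormedAddCommGroup G] [NormedSpace ℝ G] {θ : G → G →L[ℝ] ℝ} {σ : F → G} {y : F}
    (hσ : ContDiffAt ℝ 2 σ y) (hθ : DifferentiableAt ℝ θ (σ y)) (a b : F) :
    fderiv ℝ (fun y => (θ (σ y)).comp (fderiv ℝ σ y)) y a b -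
      fderiv ℝ (fun y => (θ (σ y)).comp (fderiv ℝ σ y)) y b a =
    fderiv ℝ θ (σ y) (fderiv ℝ σ y a) (fderiv ℝ σ y b) -
      fderiv ℝ θ (σ y) (fderiv ℝ σ y b) (fderiv ℝ σ y a) := by
  have h1 : HasFDerivAt σ (fderiv ℝ σ y) y := (hσ.differentiableAt (by simp)).hasFDerivAt
  have h2 : DifferentiableAt ℝ (fderiv ℝ σ) y :=
    (hσ.fderiv_right (m := 1) (by norm_num)).differentiableAt (by simp)
  have h3 := hθ.hasFDerivAt.comp y h1
  have h4 := h3.clm_comp h2.hasFDerivAt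
  -- The product rule leaves a term in the second derivative of `σ`, which is symmetric and drops
  -- out of the antisymmetrization.
  have hsymm : IsSymmSndFDerivAt ℝ σ y := hσ.isSymmSndFDerivAt (by simp)
  have h5 : fderiv ℝ (fun y => (θ (σ y)).comp (fderiv ℝ σ y)) y = _ := h4.fderiv
  rw [h5]
  simp [hsymm.eq a b]

/-! ### Linear algebra of the contact equations at one point. -/

section VerticalNondegeneracy

variable {E : Type*} [AddCommGroup E] [Module ℝ E]

/-- The linear algebra of the equation `♭_L(u) - dE_L + (E_L + R_L(E_L)) η_L = A` in coordinates
`w = ((w_q, w_v), w_z)`, with `B` the derivative of the momentum `∂L/∂q̇` and `dl` that of `L`. -/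
theorem coord_equations_of_flat_eq {B : (E × E) × ℝ →ₗ[ℝ] E →ₗ[ℝ] ℝ} {dl : (E × E) × ℝ →ₗ[ℝ] ℝ}
    {v : E} {ly : ℝ} (hB : ∀ a, (∀ b, B ((0, b), 0) a = 0) → a = 0) {u : (E × E) × ℝ} {r : ℝ}
    (hr : r = -dl ((0, 0), 1)) {A : E →ₗ[ℝ] ℝ}
    (h : ∀ w : (E × E) × ℝ,
      (-(B u w.1.1) + B w u.1.1) + (u.2 - dl ((0, u.1.1), 0)) * (w.2 - dl ((0, w.1.1), 0))
        - (B w v + dl ((0, w.1.2), 0) - dl w)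
        + (dl ((0, v), 0) - ly + r) * (w.2 - dl ((0, w.1.1), 0)) = A w.1.1) :
    u.1.1 = v ∧ u.2 = ly ∧
      ∀ a, A a = -(B u a) + dl ((a, 0), 0) + dl ((0, 0), 1) * dl ((0, a), 0) := by
  have hz : dl ((0, 0), 0) = 0 := map_zero dl
  have h1 : u.1.1 = v := by
    -- On a vertical `w` both `η_L(w)` and `A w.1.1` vanish, and only `B w (u.1.1 - v)` survives.
    refine sub_eq_zero.1 (hB _ fun b => ?_)
    have := h ((0, b), 0)
    simp only [map_zero, hz] at this
    rw [map_sub]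
    linarith
  have h2 : u.2 = ly := by
    have := h ((0, 0), 1)
    simp only [map_zero, hz, h1] at this
    rw [hr] at this
    linarith
  refine ⟨h1, h2, fun a => ?_⟩
  have := h ((a, 0), 0)
  simp only [hz, h1] at this
  rw [hr, h2] at this
  linarith

/-- The solution is `∂/∂z` corrected by the vertical vector `b` that makes the momentum constant
along it. -/
theorem exists_coord_reeb {B : (E × E) × ℝ →ₗ[ℝ] E →ₗ[ℝ] ℝ} {dl : (E × E) × ℝ →ₗ[ℝ] ℝ}
    (hB : ∃ b, B ((0, b), 0) = -B ((0, 0), 1)) :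
    ∃ R : (E × E) × ℝ, (∀ w : (E × E) × ℝ, -(B R w.1.1) + B w R.1.1 = 0) ∧
      R.2 - dl ((0, R.1.1), 0) = 1 := by
  obtain ⟨b, hb⟩ := hB
  have hz : dl ((0, 0), 0) = 0 := map_zero dl
  refine ⟨((0, b), 1), fun w => ?_, by simp [hz]⟩
  have : ((0, b), 1) = (((0, b), 0) + ((0, 0), 1) : (E × E) × ℝ) := by simp
  rw [this, map_add, hb]
  simp

/-- The left-hand side is `dE_L(R)`. The two Reeb conditions force `R` to be vertical plus `∂/∂z`,
and the vertical part then cancels. This holds for any solution `R`, so no uniqueness is needed. -/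
theorem energy_deriv_coord_reeb {B : (E × E) × ℝ →ₗ[ℝ] E →ₗ[ℝ] ℝ} {dl : (E × E) × ℝ →ₗ[ℝ] ℝ}
    {v : E} (hB : ∀ a, (∀ b, B ((0, b), 0) a = 0) → a = 0) {R : (E × E) × ℝ}
    (h : ∀ w : (E × E) × ℝ, -(B R w.1.1) + B w R.1.1 = 0) (h1 : R.2 - dl ((0, R.1.1), 0) = 1) :
    B R v + dl ((0, R.1.2), 0) - dl R = -dl ((0, 0), 1) := by
  have hz : dl ((0, 0), 0) = 0 := map_zero dl
  have hq : R.1.1 = 0 := hB _ fun b => by simpa using h ((0, b), 0)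
  have hv : B R v = 0 := by simpa [hq] using h ((v, 0), 0)
  have h2 : R.2 = 1 := by rw [hq, hz] at h1; linarith
  have : R = (((0, R.1.2), 0) + ((0, 0), 1) : (E × E) × ℝ) := by
    ext <;> simp [hq, h2]
  rw [hv]
  nth_rw 2 [this]
  rw [map_add]
  ring

end VerticalNondegeneracy

/-! ### Invariance of a linear constraint, in coordinates. -/

open Filter Topology in
/-- A solution of `ċ = F(c)` stays in the zero set of a family `f` of independent functions, linear
in the velocities, to which `F` is tangent. -/
theorem eventually_constraint_eq_zero {E V : Type*} [NormedAddCommGroup E] [NormedSpace ℝ E]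
    [NormedAddCommGroup V] [NormedSpace ℝ V] [CompleteSpace V] {O : Set E} (hO : IsOpen O)
    {f : (E × E) × ℝ → V} (hf : ContDiffOn ℝ ∞ f {y | y.1.1 ∈ O})
    (hlin : ∀ x ∈ O, ∃ A : E →ₗ[ℝ] V, ∀ v z, f ((x, v), z) = A v)
    {F : (E × E) × ℝ → (E × E) × ℝ} (hF : ContDiffOn ℝ ∞ F {y | y.1.1 ∈ O})
    (htan : ∀ y, y.1.1 ∈ O → f y = 0 → fderiv ℝ f y (F y) = 0)
    {c : ℝ → (E × E) × ℝ} {t₀ : ℝ} (hc : ∀ᶠ t in 𝓝 t₀, HasDerivAt c (F (c t)) t)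
    (hO₀ : (c t₀).1.1 ∈ O) (hsurj : ∃ A₀ : V →L[ℝ] E, ∀ w z, f (((c t₀).1.1, A₀ w), z) = w)
    (h0 : f (c t₀) = 0) : ∀ᶠ t in 𝓝 t₀, f (c t) = 0 := by
  have hW : IsOpen {y : (E × E) × ℝ | y.1.1 ∈ O} :=
    hO.preimage (continuous_fst.comp continuous_fst)
  obtain ⟨A₀, hA₀⟩ := hsurj
  have hdiff : ∀ y : (E × E) × ℝ, y.1.1 ∈ O → DifferentiableAt ℝ f y := fun y hy =>
    (hf.contDiffAt (hW.mem_nhds hy)).differentiableAt (by simp)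
  -- As `f` is linear in the velocity, its vertical derivative is `f` itself evaluated at the
  -- direction.
  have hvert : ∀ (y : (E × E) × ℝ) (b : E), y.1.1 ∈ O →
      fderiv ℝ f y ((0, b), 0) = f ((y.1.1, b), y.2) := by
    rintro ⟨⟨x, v⟩, z⟩ b hx
    obtain ⟨A, hA⟩ := hlin x hx
    have h1 : HasDerivAt (fun s : ℝ => (((x, v), z) + s • ((0, b), 0) : (E × E) × ℝ))
        ((0, b), 0) 0 := by
      simpa using ((hasDerivAt_id (0 : ℝ)).smul_const ((0, b), (0 : ℝ))).const_add ((x, v), z)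
    have h2 : HasFDerivAt f (fderiv ℝ f ((x, v), z))
        (((x, v), z) + (0 : ℝ) • ((0, b), 0) : (E × E) × ℝ) := by
      simpa using (hdiff _ hx).hasFDerivAt
    have h3 := h2.comp_hasDerivAt (0 : ℝ) h1
    have h4 : HasDerivAt (fun s : ℝ => A v + s • A b) (A b) 0 := by
      simpa using ((hasDerivAt_id (0 : ℝ)).smul_const (A b)).const_add (A v)
    have h5 : (f ∘ fun s : ℝ => (((x, v), z) + s • ((0, b), 0) : (E × E) × ℝ)) =
        fun s : ℝ => A v + s • A b := by
      funext s
      simp [hA]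
    rw [h5] at h3
    rw [h3.unique h4, hA]
  set y₀ := c t₀ with hy₀
  -- `B y` is the map `w ↦ f ((q, A₀ w), z)`, written through `fderiv` so that its continuity in `y`
  -- is immediate. It is the identity at `y₀`, hence invertible nearby.
  set B : (E × E) × ℝ → V →L[ℝ] V := fun y => (fderiv ℝ f y).comp
    (((ContinuousLinearMap.inl ℝ (E × E) ℝ).comp (ContinuousLinearMap.inr ℝ E E)).comp A₀) with hB
  have hBapp : ∀ y w, y.1.1 ∈ O → B y w = f ((y.1.1, A₀ w), y.2) := fun y w hy => by
    rw [← hvert y _ hy]; rfl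
  have hfd : ContDiffOn ℝ ∞ (fderiv ℝ f) {y | y.1.1 ∈ O} :=
    hf.fderiv_of_isOpen hW (by simp)
  have hBcont : ContinuousAt B y₀ := by
    have : ContinuousAt (fderiv ℝ f) y₀ := (hfd.contDiffAt (hW.mem_nhds hO₀)).continuousAt
    exact this.clm_comp continuousAt_const
  have hB₀ : B y₀ = 1 := by
    ext w
    rw [hBapp _ _ hO₀, hA₀]; rfl
  have hBi : ContinuousAt (fun y => Ring.inverse (B y)) y₀ := by
    have h1 : ContinuousAt Ring.inverse (B y₀) := by
      rw [hB₀]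
      exact NormedRing.inverse_continuousAt (1 : (V →L[ℝ] V)ˣ)
    exact ContinuousAt.comp h1 hBcont
  have hunit : ∀ᶠ y in 𝓝 y₀, IsUnit (B y) :=
    hBcont (Units.isOpen.mem_nhds (by rw [hB₀]; exact isUnit_one))
  -- Correction of the velocity along the range of `A₀`: by linearity a single Newton step lands
  -- exactly on `f = 0`, and the displacement is `O(‖f y‖)`.
  set pr : (E × E) × ℝ → (E × E) × ℝ := fun y =>
    y - ((0, A₀ (Ring.inverse (B y) (f y))), 0) with hpr
  have hprc : Tendsto pr (𝓝 y₀) (𝓝 y₀) := by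
    have h1 : ContinuousAt (fun y => A₀ (Ring.inverse (B y) (f y))) y₀ :=
      A₀.continuous.continuousAt.comp (hBi.clm_apply (hdiff _ hO₀).continuousAt)
    have h2 : ContinuousAt pr y₀ :=
      continuousAt_id.sub ((continuousAt_const.prodMk h1).prodMk continuousAt_const)
    have h3 : pr y₀ = y₀ := by simp [hpr, h0]
    rw [ContinuousAt, h3] at h2
    exact h2
  have hpr0 : ∀ y, y.1.1 ∈ O → IsUnit (B y) → f (pr y) = 0 := by
    intro y hy hu
    obtain ⟨A, hA⟩ := hlin _ hy
    have h1 : pr y = ((y.1.1, y.1.2 - A₀ (Ring.inverse (B y) (f y))), y.2) := by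
      ext <;> simp [hpr]
    have h2 : f y = A y.1.2 := hA _ y.2
    have h3 : A (A₀ (Ring.inverse (B y) (f y))) = f y := by
      rw [← hA _ y.2, ← hBapp _ _ hy, ← mul_apply_eq_comp,
        Ring.mul_inverse_cancel _ hu]
      rfl
    rw [h1, hA, map_sub, h3, h2, sub_self]
  set g : (E × E) × ℝ → V := fun y => fderiv ℝ f y (F y) with hg
  have hgc : ContDiffAt ℝ 1 g y₀ :=
    ((hfd.clm_apply hF).contDiffAt (hW.mem_nhds hO₀)).of_le (by exact_mod_cast le_top)
  obtain ⟨K, T, hT, hlip⟩ := hgc.exists_lipschitzOnWith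
  have hOnear : ∀ᶠ y in 𝓝 y₀, y.1.1 ∈ O := hW.mem_nhds hO₀
  -- Since `g` vanishes at `pr y` by tangency, `‖g y‖` is at most the Lipschitz constant times `‖y -
  -- pr y‖`. The `+ 1` gives a bound for `‖(B y)⁻¹‖` valid near `y₀`.
  have hbound : ∀ᶠ y in 𝓝 y₀, ‖g y‖ ≤ K * ‖A₀‖ * (‖Ring.inverse (B y₀)‖ + 1) * ‖f y‖ := by
    have hnorm : ∀ᶠ y in 𝓝 y₀, ‖Ring.inverse (B y)‖ < ‖Ring.inverse (B y₀)‖ + 1 :=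
      hBi.norm.eventually (gt_mem_nhds (lt_add_one _))
    filter_upwards [hOnear, hunit, hnorm, hT, hprc hT, hprc hOnear] with y hy hu hn hyT hpT hpO
    have h1 : g (pr y) = 0 := htan _ hpO (hpr0 y hy hu)
    have h2 := hlip.dist_le_mul _ hyT _ hpT
    rw [h1, dist_zero_right, dist_eq_norm] at h2
    have h3 : y - pr y = ((0, A₀ (Ring.inverse (B y) (f y))), 0) := by simp [hpr]
    have h4 : ‖y - pr y‖ = ‖A₀ (Ring.inverse (B y) (f y))‖ := by
      rw [h3, Prod.norm_def, Prod.norm_def]; simp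
    calc ‖g y‖ ≤ K * ‖A₀ (Ring.inverse (B y) (f y))‖ := h4 ▸ h2
      _ ≤ K * (‖A₀‖ * ((‖Ring.inverse (B y₀)‖ + 1) * ‖f y‖)) := by
        gcongr
        refine (A₀.le_opNorm _).trans ?_
        gcongr
        refine (ContinuousLinearMap.le_opNorm _ _).trans ?_
        gcongr
      _ = _ := by ring
  have hcc : ContinuousAt c t₀ := hc.self_of_nhds.continuousAt
  refine eventually_eq_zero_of_norm_deriv_le (h' := fun t => g (c t)) ?_ (hcc hbound) h0
  filter_upwards [hc, hcc hOnear] with t ht htO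
  exact (hdiff _ htO).hasFDerivAt.comp_hasDerivAt t ht

/-! ### Chart independence of the exterior derivative. -/

open Filter Topology in
/-- The exterior derivative on a manifold, computed in an arbitrary parametrization `ψ` with
inverse `χ`. -/
theorem contrExtDeriv_apply_of_parametrization {F G : Type*} [NormedAddCommGroup F]
    [NormedSpace ℝ F] [NormedAddCommGroup G] [NormedSpace ℝ G] {H : Type*} [TopologicalSpace H]
    {M : Type*} [TopologicalSpace M] [ChartedSpace H M] {J : ModelWithCorners ℝ F H}
    [J.Boundaryless] [IsManifold J ∞ M] {θ : (x : M) → TangentSpace J x →L[ℝ] ℝ}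
    {ψ : G → M} {χ : M → G} {y : G}
    (hψ : ∀ᶠ y' in 𝓝 y, MDifferentiableAt 𝓘(ℝ, G) J ψ y')
    (hχ : ContMDiffAt J 𝓘(ℝ, G) ∞ χ (ψ y))
    (hψχ : ∀ᶠ x in 𝓝 (ψ y), ψ (χ x) = x) (hχψ : ∀ᶠ y' in 𝓝 y, χ (ψ y') = y')
    {θ' : G → G →L[ℝ] ℝ} (hθ' : ∀ᶠ y' in 𝓝 y, θ' y' = (θ (ψ y')).comp (mfderiv 𝓘(ℝ, G) J ψ y'))
    (hd : DifferentiableAt ℝ θ' y) (u w : G) :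
    contrExtDeriv J θ (ψ y) (mfderiv 𝓘(ℝ, G) J ψ y u) (mfderiv 𝓘(ℝ, G) J ψ y w) =
      fderiv ℝ θ' y u w - fderiv ℝ θ' y w u := by
  set x := ψ y with hx
  set φ := extChartAt J x with hφ
  have hχx : χ x = y := hχψ.self_of_nhds
  have hφx : φ.symm (φ x) = x := extChartAt_to_inv x
  have hsymm : ContMDiffAt 𝓘(ℝ, F) J ∞ φ.symm (φ x) :=
    (contMDiffOn_extChartAt_symm x).contMDiffAt (extChartAt_target_mem_nhds x)
  have hχ' : ContMDiffAt J 𝓘(ℝ, G) ∞ χ (φ.symm (φ x)) := by rwa [hφx]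
  -- Transition map from the preferred chart, used in the definition of `contrExtDeriv`, to the
  -- parametrization `ψ`.
  set σ : F → G := χ ∘ φ.symm with hσ
  have hσx : σ (φ x) = y := by simp [hσ, hφx, hχx]
  have hσs : ContDiffAt ℝ ∞ σ (φ x) := (hχ'.comp _ hsymm).contDiffAt
  have hsc : Tendsto φ.symm (𝓝 (φ x)) (𝓝 x) := by
    have := hsymm.continuousAt
    rwa [ContinuousAt, hφx] at this
  have hσc : Tendsto σ (𝓝 (φ x)) (𝓝 y) := by
    have := hσs.continuousAt
    rwa [ContinuousAt, hσx] at this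
  have hσd : ∀ᶠ z in 𝓝 (φ x), DifferentiableAt ℝ σ z :=
    ((hσs.of_le (m := 1) (by exact_mod_cast le_top)).eventually (by simp)).mono
      fun z hz => hz.differentiableAt (by simp)
  have hψσ : ∀ᶠ z in 𝓝 (φ x), ψ (σ z) = φ.symm z := hsc.eventually hψχ
  -- The two local expressions of `θ` are related by pull-back along `σ`; the equality is needed on
  -- a neighbourhood because it gets differentiated.
  have hform : formInChart J θ x =ᶠ[𝓝 (φ x)] fun z => (θ' (σ z)).comp (fderiv ℝ σ z) := by
    filter_upwards [hψσ.eventually_nhds, hσd, hσc.eventually hθ', hσc.eventually hψ]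
      with z hz hdz hθz hψz
    have h1 : HasMFDerivAt 𝓘(ℝ, F) J (ψ ∘ σ) z
        ((mfderiv 𝓘(ℝ, G) J ψ (σ z)).comp (fderiv ℝ σ z)) :=
      hψz.hasMFDerivAt.comp z hdz.hasFDerivAt.hasMFDerivAt
    have h2 : mfderiv 𝓘(ℝ, F) J φ.symm z = (mfderiv 𝓘(ℝ, G) J ψ (σ z)).comp (fderiv ℝ σ z) :=
      (h1.congr_of_eventuallyEq (hz.mono fun a ha => ha.symm)).mfderiv
    rw [hθz, formInChart, ← hφ, h2, ← hz.self_of_nhds]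
    rfl
  -- Chain rule for `σ ∘ φ ∘ ψ = id` near `y`.
  have hA : ∀ a : G, fderiv ℝ σ (φ x) (mfderiv J 𝓘(ℝ, F) φ x (mfderiv 𝓘(ℝ, G) J ψ y a)) = a := by
    intro a
    have h1 : HasMFDerivAt 𝓘(ℝ, G) 𝓘(ℝ, F) (φ ∘ ψ) y
        ((mfderiv J 𝓘(ℝ, F) φ x).comp (mfderiv 𝓘(ℝ, G) J ψ y)) :=
      (mdifferentiableAt_extChartAt (mem_chart_source H x)).hasMFDerivAt.comp y
        hψ.self_of_nhds.hasMFDerivAt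
    have h2 : HasMFDerivAt 𝓘(ℝ, F) 𝓘(ℝ, G) σ ((φ ∘ ψ) y) (fderiv ℝ σ (φ x)) :=
      hσd.self_of_nhds.hasFDerivAt.hasMFDerivAt
    have h3 := h2.comp y h1
    have h4 : σ ∘ (φ ∘ ψ) =ᶠ[𝓝 y] id := by
      filter_upwards [hχψ, hψ.self_of_nhds.continuousAt (extChartAt_source_mem_nhds (I := J) x)]
        with y' h5 h6
      simp only [hσ, Function.comp_apply, id_eq]
      rw [hφ, PartialEquiv.left_inv _ h6, h5]
    have h5 := (h3.congr_of_eventuallyEq h4.symm).mfderiv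
    rw [mfderiv_id] at h5
    exact (DFunLike.congr_fun h5 a).symm
  have hd' : DifferentiableAt ℝ θ' (σ (φ x)) := by rwa [hσx]
  have key := fderiv_pullback_antisymm (hσs.of_le (WithTop.coe_le_coe.2 (le_top : (2 : ℕ∞) ≤ ⊤))) hd'
    (mfderiv J 𝓘(ℝ, F) φ x (mfderiv 𝓘(ℝ, G) J ψ y u))
    (mfderiv J 𝓘(ℝ, F) φ x (mfderiv 𝓘(ℝ, G) J ψ y w))
  rw [hA, hA, hσx, ← hform.fderiv_eq] at key
  exact key

/-! ### Natural coordinates on `TQ × ℝ` and their smoothness. -/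

noncomputable section NaturalCoordinates

variable {n k : ℕ} {Q : Type*} [TopologicalSpace Q] [ChartedSpace (Coord n) Q]

/-- The coordinate space of `TQ × ℝ`. -/
abbrev CoordPhase (n : ℕ) := (Coord n × Coord n) × ℝ

/-- The inverse of the natural coordinates of `TQ × ℝ`. -/
def natParam (e : OpenPartialHomeomorph Q (Coord n)) (y : CoordPhase n) : Phase n Q :=
  (natCoord e y.1.1 y.1.2, y.2)

/-- The natural coordinates of `TQ × ℝ`. -/
def natChart (e : OpenPartialHomeomorph Q (Coord n)) (p : Phase n Q) : CoordPhase n :=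
  ((e p.1.1, mfderiv 𝓘(ℝ, Coord n) 𝓘(ℝ, Coord n) e p.1.1 p.1.2), p.2)

variable {e : OpenPartialHomeomorph Q (Coord n)}

theorem mdifferentiable_of_mem_maximalAtlas
    (he : e ∈ IsManifold.maximalAtlas 𝓘(ℝ, Coord n) ∞ Q) :
    e.MDifferentiable 𝓘(ℝ, Coord n) 𝓘(ℝ, Coord n) :=
  ⟨(contMDiffOn_of_mem_maximalAtlas he).mdifferentiableOn (by simp),
    (contMDiffOn_symm_of_mem_maximalAtlas he).mdifferentiableOn (by simp)⟩

theorem isOpen_coord_source (O : Set (Coord n)) (hO : IsOpen O) :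
    IsOpen {y : CoordPhase n | y.1.1 ∈ O} :=
  hO.preimage (continuous_fst.comp continuous_fst)

theorem natChart_natParam
    (he : e ∈ IsManifold.maximalAtlas 𝓘(ℝ, Coord n) ∞ Q) {y : CoordPhase n} (hy : y.1.1 ∈ e.target) :
    natChart e (natParam e y) = y := by
  have h := (mdifferentiable_of_mem_maximalAtlas he).comp_symm_deriv hy
  have h1 := DFunLike.congr_fun h y.1.2
  refine Prod.ext (Prod.ext (e.right_inv hy) ?_) rfl
  exact h1

theorem natParam_natChart
    (he : e ∈ IsManifold.maximalAtlas 𝓘(ℝ, Coord n) ∞ Q) {p : Phase n Q} (hp : p.1.1 ∈ e.source) :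
    natParam e (natChart e p) = p := by
  have h := (mdifferentiable_of_mem_maximalAtlas he).symm_comp_deriv hp
  obtain ⟨⟨q, v⟩, z⟩ := p
  have h1 : mfderiv 𝓘(ℝ, Coord n) 𝓘(ℝ, Coord n) e.symm (e q)
      (mfderiv 𝓘(ℝ, Coord n) 𝓘(ℝ, Coord n) e q v) = v := DFunLike.congr_fun h v
  refine Prod.ext ?_ rfl
  have h2 := e.left_inv hp
  simp only [natParam, natChart, natCoord]
  simp only at h2
  -- All tangent spaces of `Q` are by definition the model space, so an ordinary equality of fibre
  -- components suffices.
  exact Bundle.TotalSpace.ext h2 (heq_of_eq h1)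

variable [IsManifold 𝓘(ℝ, Coord n) ∞ Q]

theorem continuous_phase_base : Continuous fun p : Phase n Q => p.1.1 :=
  (FiberBundle.continuous_proj _ _).comp continuous_fst

theorem contMDiff_phase_base : ContMDiff (phaseModel n) 𝓘(ℝ, Coord n) ∞ (proj : Phase n Q → Q) :=
  (Bundle.contMDiff_proj (TangentSpace 𝓘(ℝ, Coord n))).comp contMDiff_fst

theorem contMDiff_mk_tangentBundle_model :
    ContMDiff 𝓘(ℝ, Coord n × Coord n) 𝓘(ℝ, Coord n).tangent ∞
      (fun y : Coord n × Coord n => (⟨y.1, y.2⟩ : TangentBundle 𝓘(ℝ, Coord n) (Coord n))) := by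
  rw [modelWithCornersSelf_prod]
  exact contMDiff_tangentBundleModelSpaceHomeomorph_symm (I := 𝓘(ℝ, Coord n))

/-- The `TQ` component is the tangent map of `e.symm`, read through the identification of `Tℝⁿ` with
`ℝⁿ × ℝⁿ`. -/
theorem contMDiffOn_natParam
    (he : e ∈ IsManifold.maximalAtlas 𝓘(ℝ, Coord n) ∞ Q) :
    ContMDiffOn 𝓘(ℝ, CoordPhase n) (phaseModel n) ∞ (natParam e : CoordPhase n → Phase n Q)
      {y | y.1.1 ∈ e.target} := by
  have h1 := (contMDiffOn_symm_of_mem_maximalAtlas he).contMDiffOn_tangentMapWithin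
    (m := ∞) (by simp) e.open_target.uniqueMDiffOn
  have h2 : ContMDiff 𝓘(ℝ, CoordPhase n) 𝓘(ℝ, Coord n).tangent ∞ fun y : CoordPhase n =>
      (⟨y.1.1, y.1.2⟩ : TangentBundle 𝓘(ℝ, Coord n) (Coord n)) :=
    contMDiff_mk_tangentBundle_model.comp (contDiff_fst.contMDiff (𝕜 := ℝ) (E := CoordPhase n))
  refine ContMDiffOn.prodMk ?_ (contDiff_snd.contMDiff (𝕜 := ℝ) (E := CoordPhase n)).contMDiffOn
  refine (h1.comp h2.contMDiffOn fun y hy => hy).congr fun y hy => ?_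
  simp only [Function.comp_apply, tangentMapWithin, natCoord]
  rw [mfderivWithin_of_isOpen e.open_target hy]

theorem contMDiffOn_natChart
    (he : e ∈ IsManifold.maximalAtlas 𝓘(ℝ, Coord n) ∞ Q) :
    ContMDiffOn (phaseModel n) 𝓘(ℝ, CoordPhase n) ∞ (natChart e : Phase n Q → CoordPhase n)
      {p | p.1.1 ∈ e.source} := by
  have h1 := (contMDiffOn_of_mem_maximalAtlas he).contMDiffOn_tangentMapWithin
    (m := ∞) (by simp) e.open_source.uniqueMDiffOn
  have h2 : ContMDiffOn (phaseModel n) 𝓘(ℝ, Coord n).tangent ∞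
      (fun p : Phase n Q => tangentMapWithin 𝓘(ℝ, Coord n) 𝓘(ℝ, Coord n) e e.source p.1)
      {p | p.1.1 ∈ e.source} :=
    h1.comp contMDiff_fst.contMDiffOn fun y hy => hy
  have h3 := (contMDiff_snd_tangentBundle_modelSpace (n := ∞) (Coord n)
    𝓘(ℝ, Coord n)).comp_contMDiffOn h2
  have h4 := (contMDiffOn_of_mem_maximalAtlas he).comp
    (contMDiff_phase_base (n := n) (Q := Q)).contMDiffOn (fun p (hp : p.1.1 ∈ e.source) => hp)
  refine ((h4.prodMk_space h3).congr ?_).prodMk_space contMDiff_snd.contMDiffOn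
  intro p hp
  exact congrArg (fun A : Coord n →L[ℝ] Coord n => (e p.1.1, A p.1.2))
    (mfderivWithin_of_isOpen e.open_source hp).symm

theorem contMDiffAt_natParam
    (he : e ∈ IsManifold.maximalAtlas 𝓘(ℝ, Coord n) ∞ Q) {y : CoordPhase n} (hy : y.1.1 ∈ e.target) :
    ContMDiffAt 𝓘(ℝ, CoordPhase n) (phaseModel n) ∞ (natParam e : CoordPhase n → Phase n Q) y :=
  (contMDiffOn_natParam he).contMDiffAt ((isOpen_coord_source _ e.open_target).mem_nhds hy)

theorem contMDiffAt_natChart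
    (he : e ∈ IsManifold.maximalAtlas 𝓘(ℝ, Coord n) ∞ Q) {p : Phase n Q} (hp : p.1.1 ∈ e.source) :
    ContMDiffAt (phaseModel n) 𝓘(ℝ, CoordPhase n) ∞ (natChart e : Phase n Q → CoordPhase n) p :=
  (contMDiffOn_natChart he).contMDiffAt
    ((e.open_source.preimage continuous_phase_base).mem_nhds hp)

theorem mdifferentiableAt_natParam
    (he : e ∈ IsManifold.maximalAtlas 𝓘(ℝ, Coord n) ∞ Q) {y : CoordPhase n} (hy : y.1.1 ∈ e.target) :
    MDifferentiableAt 𝓘(ℝ, CoordPhase n) (phaseModel n) (natParam e : CoordPhase n → Phase n Q) y :=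
  (contMDiffAt_natParam he hy).mdifferentiableAt (by simp)

theorem mdifferentiableAt_natChart
    (he : e ∈ IsManifold.maximalAtlas 𝓘(ℝ, Coord n) ∞ Q) {p : Phase n Q} (hp : p.1.1 ∈ e.source) :
    MDifferentiableAt (phaseModel n) 𝓘(ℝ, CoordPhase n) (natChart e : Phase n Q → CoordPhase n) p :=
  (contMDiffAt_natChart he hp).mdifferentiableAt (by simp)

/-- The tangent map of the inverse of the natural coordinates. -/
def dParam (e : OpenPartialHomeomorph Q (Coord n)) (y : CoordPhase n) :
    CoordPhase n →L[ℝ] PSpace (natParam e y : Phase n Q) :=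
  mfderiv 𝓘(ℝ, CoordPhase n) (phaseModel n) (natParam e : CoordPhase n → Phase n Q) y

/-- The tangent map of the natural coordinates. -/
def dChart (e : OpenPartialHomeomorph Q (Coord n)) (p : Phase n Q) :
    PSpace p →L[ℝ] CoordPhase n :=
  mfderiv (phaseModel n) 𝓘(ℝ, CoordPhase n) (natChart e : Phase n Q → CoordPhase n) p

/-- Every tangent vector thus comes from coordinates, so covectors need only be tested on the range
of `dParam`. -/
theorem dParam_dChart
    (he : e ∈ IsManifold.maximalAtlas 𝓘(ℝ, Coord n) ∞ Q) {y : CoordPhase n} (hy : y.1.1 ∈ e.target)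
    (w : PSpace (natParam e y : Phase n Q)) : dParam e y (dChart e (natParam e y) w) = w := by
  have hs : (natParam e y : Phase n Q).1.1 ∈ e.source := e.map_target hy
  have h1 := (mdifferentiableAt_natChart he hs).hasMFDerivAt
  have h2 : HasMFDerivAt 𝓘(ℝ, CoordPhase n) (phaseModel n)
      (natParam e : CoordPhase n → Phase n Q) (natChart e (natParam e y)) (dParam e y) := by
    rw [natChart_natParam he hy]
    exact (mdifferentiableAt_natParam he hy).hasMFDerivAt
  have h3 := (h2.comp _ h1).congr_of_eventuallyEq (f₁ := id) (by
    filter_upwards [(e.open_source.preimage continuous_phase_base).mem_nhds hs] with p hp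
    exact (natParam_natChart he hp).symm)
  have h4 := h3.mfderiv
  rw [mfderiv_id] at h4
  exact (DFunLike.congr_fun h4 w).symm

end NaturalCoordinates

/-! ### Coordinate expressions of the vertical lift, `η_L`, `E_L` and `dη_L`. -/

noncomputable section CoordinateExpressions

variable {n k : ℕ} {Q : Type*} [TopologicalSpace Q] [ChartedSpace (Coord n) Q]
  [IsManifold 𝓘(ℝ, Coord n) ∞ Q] {e : OpenPartialHomeomorph Q (Coord n)}

theorem tProj_dParam (he : e ∈ IsManifold.maximalAtlas 𝓘(ℝ, Coord n) ∞ Q) {y : CoordPhase n}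
    (hy : y.1.1 ∈ e.target) (w : CoordPhase n) :
    tProj (natParam e y : Phase n Q) (dParam e y w) =
      mfderiv 𝓘(ℝ, Coord n) 𝓘(ℝ, Coord n) e.symm y.1.1 w.1.1 := by
  have h1 := ((contMDiff_phase_base (n := n) (Q := Q)).mdifferentiableAt
    (x := natParam e y) (by simp)).hasMFDerivAt
  have h2 := h1.comp y (mdifferentiableAt_natParam he hy).hasMFDerivAt
  have h3 : HasMFDerivAt 𝓘(ℝ, CoordPhase n) 𝓘(ℝ, Coord n) (fun y : CoordPhase n => y.1.1) y
      ((ContinuousLinearMap.fst ℝ (Coord n) (Coord n)).comp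
        (ContinuousLinearMap.fst ℝ (Coord n × Coord n) ℝ)) :=
    (hasFDerivAt_fst.comp y hasFDerivAt_fst).hasMFDerivAt
  have h4 := ((mdifferentiable_of_mem_maximalAtlas he).mdifferentiableAt_symm
    hy).hasMFDerivAt.comp y h3
  exact DFunLike.congr_fun (hasMFDerivAt_unique h2 h4) w

theorem vertLift_natParam (he : e ∈ IsManifold.maximalAtlas 𝓘(ℝ, Coord n) ∞ Q) {y : CoordPhase n}
    (hy : y.1.1 ∈ e.target) (a : Coord n) :
    vertLift (natParam e y : Phase n Q)
      (mfderiv 𝓘(ℝ, Coord n) 𝓘(ℝ, Coord n) e.symm y.1.1 a) = dParam e y ((0, a), 0) := by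
  obtain ⟨⟨x, v⟩, z⟩ := y
  set T : Coord n →L[ℝ] Coord n := mfderiv 𝓘(ℝ, Coord n) 𝓘(ℝ, Coord n) e (e.symm x) with hT
  set S : Coord n →L[ℝ] Coord n := mfderiv 𝓘(ℝ, Coord n) 𝓘(ℝ, Coord n) e.symm x with hS
  have hd := mdifferentiable_of_mem_maximalAtlas he
  have hTS : ∀ b, T (S b) = b := fun b => DFunLike.congr_fun (hd.comp_symm_deriv hy) b
  have hST : ∀ b, S (T b) = b := fun b => by
    have h := hd.symm_comp_deriv (e.map_target hy)
    rw [e.right_inv hy] at h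
    exact DFunLike.congr_fun h b
  have h1 : HasFDerivAt (fun u : Coord n => (((x, T u), z) : CoordPhase n))
      (((0 : Coord n →L[ℝ] Coord n).prod T).prod (0 : Coord n →L[ℝ] ℝ)) (S v) :=
    ((hasFDerivAt_const x _).prodMk T.hasFDerivAt).prodMk (hasFDerivAt_const z _)
  have h2 : HasMFDerivAt 𝓘(ℝ, CoordPhase n) (phaseModel n)
      (natParam e : CoordPhase n → Phase n Q) ((x, T (S v)), z) (dParam e ((x, v), z)) := by
    rw [hTS]
    exact (mdifferentiableAt_natParam he hy).hasMFDerivAt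
  have h3 := h2.comp (S v) h1.hasMFDerivAt
  -- The inclusion of the fibre is `natParam` composed with the linear map `T` in the velocity slot,
  -- because `S` inverts `T`.
  have h4 : (natParam e : CoordPhase n → Phase n Q) ∘
      (fun u : Coord n => (((x, T u), z) : CoordPhase n)) =
      fun u : Coord n => ((⟨e.symm x, u⟩, z) : Phase n Q) := by
    funext u
    simp only [Function.comp_apply, natParam, natCoord]
    exact congrArg (fun b : Coord n => ((⟨e.symm x, b⟩, z) : Phase n Q)) (hST u)
  rw [h4] at h3
  have h5 := DFunLike.congr_fun h3.mfderiv (S a)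
  refine Eq.trans h5 ?_
  exact congrArg (fun b : Coord n => dParam e ((x, v), z) ((0, b), 0)) (hTS a)

theorem differential_dParam (he : e ∈ IsManifold.maximalAtlas 𝓘(ℝ, Coord n) ∞ Q)
    {y : CoordPhase n} (hy : y.1.1 ∈ e.target) {f : Phase n Q → ℝ}
    (hf : MDifferentiableAt (phaseModel n) 𝓘(ℝ, ℝ) f (natParam e y)) (w : CoordPhase n) :
    differential (phaseModel n) f (natParam e y) (dParam e y w) =
      fderiv ℝ (fun y => f (natParam e y)) y w := by
  have h := (hf.hasMFDerivAt.comp y (mdifferentiableAt_natParam he hy).hasMFDerivAt).mfderiv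
  rw [mfderiv_eq_fderiv] at h
  exact (DFunLike.congr_fun h w).symm

/-- The momentum covector `∂l/∂q̇`. -/
def momentum (l : CoordPhase n → ℝ) (y : CoordPhase n) : Coord n →L[ℝ] ℝ :=
  (fderiv ℝ l y).comp ((ContinuousLinearMap.inl ℝ (Coord n × Coord n) ℝ).comp
    (ContinuousLinearMap.inr ℝ (Coord n) (Coord n)))

theorem momentum_apply (l : CoordPhase n → ℝ) (y : CoordPhase n) (a : Coord n) :
    momentum l y a = fderiv ℝ l y ((0, a), 0) := rfl

theorem contDiffOn_natParam_comp (he : e ∈ IsManifold.maximalAtlas 𝓘(ℝ, Coord n) ∞ Q)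
    {L : Phase n Q → ℝ} (hL : ContMDiff (phaseModel n) 𝓘(ℝ, ℝ) ∞ L) :
    ContDiffOn ℝ ∞ (fun y => L (natParam e y)) {y : CoordPhase n | y.1.1 ∈ e.target} :=
  contMDiffOn_iff_contDiffOn.1 (hL.comp_contMDiffOn (contMDiffOn_natParam he))

theorem contDiffOn_momentum {l : CoordPhase n → ℝ} {O : Set (Coord n)} (hO : IsOpen O)
    (hl : ContDiffOn ℝ ∞ l {y : CoordPhase n | y.1.1 ∈ O}) :
    ContDiffOn ℝ ∞ (momentum l) {y : CoordPhase n | y.1.1 ∈ O} :=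
  (hl.fderiv_of_isOpen (isOpen_coord_source O hO) (by simp)).clm_comp contDiffOn_const

theorem differentiableAt_momentum {l : CoordPhase n → ℝ} {O : Set (Coord n)} (hO : IsOpen O)
    (hl : ContDiffOn ℝ ∞ l {y : CoordPhase n | y.1.1 ∈ O}) {y : CoordPhase n} (hy : y.1.1 ∈ O) :
    DifferentiableAt ℝ (momentum l) y :=
  ((contDiffOn_momentum hO hl).contDiffAt
    ((isOpen_coord_source O hO).mem_nhds hy)).differentiableAt (by simp)

theorem contactForm_dParam (he : e ∈ IsManifold.maximalAtlas 𝓘(ℝ, Coord n) ∞ Q)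
    {L : Phase n Q → ℝ} (hL : ContMDiff (phaseModel n) 𝓘(ℝ, ℝ) ∞ L)
    {y : CoordPhase n} (hy : y.1.1 ∈ e.target) (w : CoordPhase n) :
    contactForm L (natParam e y) (dParam e y w) =
      w.2 - momentum (fun y => L (natParam e y)) y w.1.1 := by
  have h1 : differential (phaseModel n) (fun p' : Phase n Q => p'.2) (natParam e y)
      (dParam e y w) = w.2 := by
    rw [differential_dParam he hy ((contMDiff_snd (n := ∞)).mdifferentiableAt (by simp))]
    exact DFunLike.congr_fun (hasFDerivAt_snd (𝕜 := ℝ) (p := y)).fderiv w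
  have h2 : vertEndo (natParam e y : Phase n Q) (dParam e y w) = dParam e y ((0, w.1.1), 0) := by
    rw [vertEndo, ContinuousLinearMap.comp_apply, tProj_dParam he hy, vertLift_natParam he hy]
  rw [contactForm, sub_apply, ContinuousLinearMap.comp_apply, h1, h2,
    differential_dParam he hy (hL.mdifferentiableAt (by simp)), momentum_apply]

theorem liouville_natParam (he : e ∈ IsManifold.maximalAtlas 𝓘(ℝ, Coord n) ∞ Q)
    {y : CoordPhase n} (hy : y.1.1 ∈ e.target) :
    liouville (natParam e y : Phase n Q) = dParam e y ((0, y.1.2), 0) :=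
  vertLift_natParam he hy y.1.2

theorem energy_natParam (he : e ∈ IsManifold.maximalAtlas 𝓘(ℝ, Coord n) ∞ Q)
    {L : Phase n Q → ℝ} (hL : ContMDiff (phaseModel n) 𝓘(ℝ, ℝ) ∞ L)
    {y : CoordPhase n} (hy : y.1.1 ∈ e.target) :
    energy L (natParam e y) =
      momentum (fun y => L (natParam e y)) y y.1.2 - L (natParam e y) := by
  rw [energy, liouville_natParam he hy, differential_dParam he hy (hL.mdifferentiableAt (by simp)),
    momentum_apply]

open Topology in
theorem differential_energy_dParam (he : e ∈ IsManifold.maximalAtlas 𝓘(ℝ, Coord n) ∞ Q)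
    {L : Phase n Q → ℝ} (hL : ContMDiff (phaseModel n) 𝓘(ℝ, ℝ) ∞ L)
    {y : CoordPhase n} (hy : y.1.1 ∈ e.target) (w : CoordPhase n) :
    differential (phaseModel n) (energy L) (natParam e y) (dParam e y w) =
      fderiv ℝ (momentum fun y => L (natParam e y)) y w y.1.2 +
        fderiv ℝ (fun y => L (natParam e y)) y ((0, w.1.2), 0) -
        fderiv ℝ (fun y => L (natParam e y)) y w := by
  set l : CoordPhase n → ℝ := fun y => L (natParam e y) with hl
  have hlc := contDiffOn_natParam_comp he hL
  have hW := isOpen_coord_source _ e.open_target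
  have hE : (fun y => energy L (natParam e y)) =ᶠ[𝓝 y] fun y => momentum l y y.1.2 - l y := by
    filter_upwards [hW.mem_nhds hy] with y' hy'
    exact energy_natParam he hL hy'
  have hsnd : HasFDerivAt (fun y : CoordPhase n => y.1.2)
      ((ContinuousLinearMap.snd ℝ (Coord n) (Coord n)).comp
        (ContinuousLinearMap.fst ℝ (Coord n × Coord n) ℝ)) y :=
    hasFDerivAt_snd.comp y hasFDerivAt_fst
  have hd : HasFDerivAt (fun y => momentum l y y.1.2 - l y) _ y :=
    ((differentiableAt_momentum e.open_target hlc hy).hasFDerivAt.clm_apply hsnd).sub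
      ((hlc.contDiffAt (hW.mem_nhds hy)).differentiableAt (by simp)).hasFDerivAt
  have hd' := hd.congr_of_eventuallyEq hE
  -- The chain rule for `differential` needs differentiability on the manifold; it is transported
  -- from the coordinate expression by the natural chart.
  have hdE : MDifferentiableAt (phaseModel n) 𝓘(ℝ, ℝ) (energy L) (natParam e y) := by
    have hs : (natParam e y : Phase n Q).1.1 ∈ e.source := e.map_target hy
    have h1 : MDifferentiableAt 𝓘(ℝ, CoordPhase n) 𝓘(ℝ, ℝ) (fun y => energy L (natParam e y))
        (natChart e (natParam e y)) := by
      rw [natChart_natParam he hy]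
      exact hd'.differentiableAt.mdifferentiableAt
    refine (h1.comp _ (mdifferentiableAt_natChart he hs)).congr_of_eventuallyEq ?_
    filter_upwards [(e.open_source.preimage continuous_phase_base).mem_nhds hs] with p hp
    simp only [Function.comp_apply, natParam_natChart he hp]
  rw [differential_dParam he hy hdE, hd'.fderiv]
  simp [momentum_apply]
  ring

open Topology in
theorem contrExtDeriv_contactForm_dParam (he : e ∈ IsManifold.maximalAtlas 𝓘(ℝ, Coord n) ∞ Q)
    {L : Phase n Q → ℝ} (hL : ContMDiff (phaseModel n) 𝓘(ℝ, ℝ) ∞ L)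
    {y : CoordPhase n} (hy : y.1.1 ∈ e.target) (u w : CoordPhase n) :
    contrExtDeriv (phaseModel n) (contactForm L) (natParam e y) (dParam e y u) (dParam e y w) =
      -(fderiv ℝ (momentum fun y => L (natParam e y)) y u w.1.1) +
        fderiv ℝ (momentum fun y => L (natParam e y)) y w u.1.1 := by
  have hW := isOpen_coord_source _ e.open_target
  have hs : (natParam e y : Phase n Q).1.1 ∈ e.source := e.map_target hy
  set l : CoordPhase n → ℝ := fun y => L (natParam e y) with hl
  have hlc := contDiffOn_natParam_comp he hL
  set π₁ : CoordPhase n →L[ℝ] Coord n := (ContinuousLinearMap.fst ℝ (Coord n) (Coord n)).comp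
    (ContinuousLinearMap.fst ℝ (Coord n × Coord n) ℝ) with hπ
  have hd : HasFDerivAt (fun y => ContinuousLinearMap.snd ℝ (Coord n × Coord n) ℝ -
      (momentum l y).comp π₁) _ y :=
    (((differentiableAt_momentum e.open_target hlc hy).hasFDerivAt.clm_comp
      (hasFDerivAt_const π₁ y)).const_sub (ContinuousLinearMap.snd ℝ (Coord n × Coord n) ℝ))
  have key := contrExtDeriv_apply_of_parametrization (θ := contactForm L)
    (ψ := (natParam e : CoordPhase n → Phase n Q)) (χ := natChart e) (y := y)
    (by filter_upwards [hW.mem_nhds hy] with y' hy' using mdifferentiableAt_natParam he hy')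
    (contMDiffAt_natChart he hs)
    (by filter_upwards [(e.open_source.preimage continuous_phase_base).mem_nhds hs] with p hp
        using natParam_natChart he hp)
    (by filter_upwards [hW.mem_nhds hy] with y' hy' using natChart_natParam he hy')
    (by filter_upwards [hW.mem_nhds hy] with y' hy'
        refine ContinuousLinearMap.ext fun w' => ?_
        exact (contactForm_dParam he hL hy' w').symm)
    hd.differentiableAt u w
  refine key.trans ?_
  rw [hd.fderiv]
  simp [hπ]
  ring

end CoordinateExpressions

/-! ### Regularity, the Reeb vector and the dynamics at one point. -/

noncomputable section PointwiseDynamics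

variable {n k : ℕ} {Q : Type*} [TopologicalSpace Q] [ChartedSpace (Coord n) Q]
  {e : OpenPartialHomeomorph Q (Coord n)}

theorem partialQ_eq {L : Phase n Q → ℝ} {y : CoordPhase n}
    (hl : DifferentiableAt ℝ (fun y => L (natParam e y)) y) (i : Fin n) :
    partialQ (inCoord L e) i y.1.1 y.1.2 y.2 =
      fderiv ℝ (fun y => L (natParam e y)) y ((basisVec i, 0), 0) := by
  have h1 : HasFDerivAt (fun x : Coord n => (((x, y.1.2), y.2) : CoordPhase n)) _ y.1.1 :=
    ((hasFDerivAt_id (𝕜 := ℝ) y.1.1).prodMk (hasFDerivAt_const y.1.2 _)).prodMk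
      (hasFDerivAt_const y.2 _)
  exact DFunLike.congr_fun
    (HasFDerivAt.comp (g := fun y => L (natParam e y)) y.1.1 hl.hasFDerivAt h1).fderiv (basisVec i)

theorem fderiv_velocity_slice {f : CoordPhase n → ℝ} {y : CoordPhase n}
    (hf : DifferentiableAt ℝ f y) (a : Coord n) :
    fderiv ℝ (fun v => f ((y.1.1, v), y.2)) y.1.2 a = fderiv ℝ f y ((0, a), 0) := by
  have h1 : HasFDerivAt (fun v : Coord n => (((y.1.1, v), y.2) : CoordPhase n)) _ y.1.2 :=
    ((hasFDerivAt_const (𝕜 := ℝ) y.1.1 _).prodMk (hasFDerivAt_id y.1.2)).prodMk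
      (hasFDerivAt_const y.2 _)
  exact DFunLike.congr_fun (HasFDerivAt.comp (g := f) y.1.2 hf.hasFDerivAt h1).fderiv a

theorem partialV_eq {L : Phase n Q → ℝ} {y : CoordPhase n}
    (hl : DifferentiableAt ℝ (fun y => L (natParam e y)) y) (i : Fin n) :
    partialV (inCoord L e) i y.1.1 y.1.2 y.2 =
      momentum (fun y => L (natParam e y)) y (basisVec i) :=
  fderiv_velocity_slice hl _

theorem partialZ_eq {L : Phase n Q → ℝ} {y : CoordPhase n}
    (hl : DifferentiableAt ℝ (fun y => L (natParam e y)) y) :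
    partialZ (inCoord L e) y.1.1 y.1.2 y.2 =
      fderiv ℝ (fun y => L (natParam e y)) y ((0, 0), 1) := by
  have h1 : HasDerivAt (fun z : ℝ => ((y.1, z) : CoordPhase n)) ((0, 0), 1) y.2 :=
    (hasDerivAt_const y.2 y.1).prodMk (hasDerivAt_id y.2)
  exact (HasFDerivAt.comp_hasDerivAt (l := fun y => L (natParam e y)) y.2 hl.hasFDerivAt h1).deriv

theorem eq_sum_basisVec (a : Coord n) : a = ∑ i, a i • basisVec i := by
  have := (EuclideanSpace.basisFun (Fin n) ℝ).sum_repr a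
  simpa [basisVec] using this.symm

variable [IsManifold 𝓘(ℝ, Coord n) ∞ Q]

theorem differentiableAt_natParam_comp (he : e ∈ IsManifold.maximalAtlas 𝓘(ℝ, Coord n) ∞ Q)
    {L : Phase n Q → ℝ} (hL : ContMDiff (phaseModel n) 𝓘(ℝ, ℝ) ∞ L)
    {y : CoordPhase n} (hy : y.1.1 ∈ e.target) :
    DifferentiableAt ℝ (fun y => L (natParam e y)) y :=
  ((contDiffOn_natParam_comp he hL).contDiffAt
    ((isOpen_coord_source _ e.open_target).mem_nhds hy)).differentiableAt (by simp)

theorem velHessian_apply (he : e ∈ IsManifold.maximalAtlas 𝓘(ℝ, Coord n) ∞ Q)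
    {L : Phase n Q → ℝ} (hL : ContMDiff (phaseModel n) 𝓘(ℝ, ℝ) ∞ L)
    {y : CoordPhase n} (hy : y.1.1 ∈ e.target) (i j : Fin n) :
    velHessian (inCoord L e) y.1.1 y.1.2 y.2 i j =
      fderiv ℝ (momentum fun y => L (natParam e y)) y ((0, basisVec i), 0) (basisVec j) := by
  have hm := differentiableAt_momentum e.open_target (contDiffOn_natParam_comp he hL) hy
  have h1 : HasFDerivAt (fun y => momentum (fun y => L (natParam e y)) y (basisVec j)) _ y :=
    hm.hasFDerivAt.clm_apply (hasFDerivAt_const (basisVec j) y)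
  have h2 : (fun v => partialV (inCoord L e) j y.1.1 v y.2) = fun v =>
      momentum (fun y => L (natParam e y)) ((y.1.1, v), y.2) (basisVec j) := by
    funext v
    exact partialV_eq (differentiableAt_natParam_comp he hL (y := ((y.1.1, v), y.2)) hy) j
  have h3 : velHessian (inCoord L e) y.1.1 y.1.2 y.2 i j =
      fderiv ℝ (fun v => partialV (inCoord L e) j y.1.1 v y.2) y.1.2 (basisVec i) := rfl
  rw [h3, h2]
  refine (fderiv_velocity_slice h1.differentiableAt (basisVec i)).trans ?_
  rw [h1.fderiv]
  simp

/-- Taking `b` among the basis vectors, the hypothesis says that the invertible Hessian matrix kills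
`a`. -/
theorem momentum_fderiv_nondegenerate (he : e ∈ IsManifold.maximalAtlas 𝓘(ℝ, Coord n) ∞ Q)
    {L : Phase n Q → ℝ} (hL : ContMDiff (phaseModel n) 𝓘(ℝ, ℝ) ∞ L)
    (hreg : IsRegularLagrangian L) {y : CoordPhase n} (hy : y.1.1 ∈ e.target) (a : Coord n)
    (ha : ∀ b, fderiv ℝ (momentum fun y => L (natParam e y)) y ((0, b), 0) a = 0) : a = 0 := by
  have hu := hreg e he _ hy y.1.2 y.2
  have h1 : (velHessian (inCoord L e) y.1.1 y.1.2 y.2).mulVec a = 0 := by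
    funext i
    rw [Matrix.mulVec, dotProduct, Pi.zero_apply, ← ha (basisVec i)]
    conv_rhs => rw [eq_sum_basisVec a]
    simp [velHessian_apply he hL hy, mul_comm]
  have h2 := Matrix.mulVec_injective_of_isUnit hu (h1.trans (Matrix.mulVec_zero _).symm)
  ext i
  exact congrFun h2 i

theorem exists_momentum_fderiv_eq (he : e ∈ IsManifold.maximalAtlas 𝓘(ℝ, Coord n) ∞ Q)
    {L : Phase n Q → ℝ} (hL : ContMDiff (phaseModel n) 𝓘(ℝ, ℝ) ∞ L)
    (hreg : IsRegularLagrangian L) {y : CoordPhase n} (hy : y.1.1 ∈ e.target)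
    (f : Coord n →L[ℝ] ℝ) :
    ∃ b, fderiv ℝ (momentum fun y => L (natParam e y)) y ((0, b), 0) = f := by
  set B := fderiv ℝ (momentum fun y => L (natParam e y)) y with hB
  let T : Coord n →ₗ[ℝ] Coord n →ₗ[ℝ] ℝ := (ContinuousLinearMap.coeLM ℝ).comp
    (B.toLinearMap.comp ((LinearMap.inl ℝ (Coord n × Coord n) ℝ).comp
      (LinearMap.inr ℝ (Coord n) (Coord n))))
  have hT : Function.Surjective T := by
    -- In finite dimension a bilinear form that is injective in one slot is onto the dual from the
    -- other slot.
    refine LinearMap.flip_injective_iff₁.1 ((injective_iff_map_eq_zero _).2 fun a ha => ?_)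
    exact momentum_fderiv_nondegenerate he hL hreg hy a fun b => DFunLike.congr_fun ha b
  obtain ⟨b, hb⟩ := hT f
  exact ⟨b, ContinuousLinearMap.ext fun a => DFunLike.congr_fun hb a⟩

/-- `B` as a map to the algebraic dual. -/
def algDual (B : CoordPhase n →L[ℝ] Coord n →L[ℝ] ℝ) : CoordPhase n →ₗ[ℝ] Coord n →ₗ[ℝ] ℝ :=
  (ContinuousLinearMap.coeLM ℝ).comp B.toLinearMap

/-- `reeb` is a choice, so its defining properties follow once some vector has them; regularity
supplies one in coordinates. -/
theorem reeb_spec (he : e ∈ IsManifold.maximalAtlas 𝓘(ℝ, Coord n) ∞ Q)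
    {L : Phase n Q → ℝ} (hL : ContMDiff (phaseModel n) 𝓘(ℝ, ℝ) ∞ L)
    (hreg : IsRegularLagrangian L) {y : CoordPhase n} (hy : y.1.1 ∈ e.target) :
    contrExtDeriv (phaseModel n) (contactForm L) (natParam e y) (reeb L (natParam e y)) = 0 ∧
      contactForm L (natParam e y) (reeb L (natParam e y)) = 1 := by
  set B := fderiv ℝ (momentum fun y => L (natParam e y)) y with hB
  obtain ⟨b, hb⟩ := exists_momentum_fderiv_eq he hL hreg hy (-B ((0, 0), 1))
  obtain ⟨R, h1, h2⟩ := exists_coord_reeb (B := algDual B)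
    (dl := (fderiv ℝ (fun y => L (natParam e y)) y).toLinearMap)
    ⟨b, LinearMap.ext fun a => DFunLike.congr_fun hb a⟩
  refine Classical.epsilon_spec (p := fun R =>
    contrExtDeriv (phaseModel n) (contactForm L) (natParam e y) R = 0 ∧
      contactForm L (natParam e y) R = 1) ⟨dParam e y R, ?_, ?_⟩
  · refine ContinuousLinearMap.ext fun w => ?_
    rw [← dParam_dChart he hy w, contrExtDeriv_contactForm_dParam he hL hy]
    exact h1 _
  · rw [contactForm_dParam he hL hy]
    exact h2

theorem differential_energy_reeb (he : e ∈ IsManifold.maximalAtlas 𝓘(ℝ, Coord n) ∞ Q)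
    {L : Phase n Q → ℝ} (hL : ContMDiff (phaseModel n) 𝓘(ℝ, ℝ) ∞ L)
    (hreg : IsRegularLagrangian L) {y : CoordPhase n} (hy : y.1.1 ∈ e.target) :
    differential (phaseModel n) (energy L) (natParam e y) (reeb L (natParam e y)) =
      -fderiv ℝ (fun y => L (natParam e y)) y ((0, 0), 1) := by
  obtain ⟨h1, h2⟩ := reeb_spec he hL hreg hy
  rw [← dParam_dChart he hy (reeb L (natParam e y))] at h1 h2 ⊢
  set R := dChart e (natParam e y) (reeb L (natParam e y))
  rw [differential_energy_dParam he hL hy]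
  refine energy_deriv_coord_reeb (R := R) (v := y.1.2)
    (B := algDual (fderiv ℝ (momentum fun y => L (natParam e y)) y))
    (dl := (fderiv ℝ (fun y => L (natParam e y)) y).toLinearMap)
    (momentum_fderiv_nondegenerate he hL hreg hy) (fun w => ?_) ?_
  · refine (contrExtDeriv_contactForm_dParam he hL hy R w).symm.trans ?_
    rw [h1]; rfl
  · rw [contactForm_dParam he hL hy] at h2
    exact h2

/-- The equation `♭_L(X) - dE_L + (E_L + R_L(E_L)) η_L = α ∘ T(proj)` in natural coordinates. -/
theorem coord_dynamics (he : e ∈ IsManifold.maximalAtlas 𝓘(ℝ, Coord n) ∞ Q)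
    {L : Phase n Q → ℝ} (hL : ContMDiff (phaseModel n) 𝓘(ℝ, ℝ) ∞ L)
    (hreg : IsRegularLagrangian L) {y : CoordPhase n} (hy : y.1.1 ∈ e.target)
    {u : CoordPhase n} {α : TSpace n (natParam e y : Phase n Q).1.1 →L[ℝ] ℝ}
    (h : flat L (natParam e y) (dParam e y u) -
        differential (phaseModel n) (energy L) (natParam e y) +
        (energy L (natParam e y) + differential (phaseModel n) (energy L) (natParam e y)
          (reeb L (natParam e y))) • contactForm L (natParam e y) =
      α.comp (tProj (natParam e y))) :
    u.1.1 = y.1.2 ∧ u.2 = L (natParam e y) ∧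
      ∀ a, α (mfderiv 𝓘(ℝ, Coord n) 𝓘(ℝ, Coord n) e.symm y.1.1 a) =
        -(fderiv ℝ (momentum fun y => L (natParam e y)) y u a) +
          fderiv ℝ (fun y => L (natParam e y)) y ((a, 0), 0) +
          fderiv ℝ (fun y => L (natParam e y)) y ((0, 0), 1) *
            fderiv ℝ (fun y => L (natParam e y)) y ((0, a), 0) := by
  let A : Coord n →L[ℝ] ℝ := α.comp (mfderiv 𝓘(ℝ, Coord n) 𝓘(ℝ, Coord n) e.symm y.1.1)
  refine coord_equations_of_flat_eq (A := A.toLinearMap)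
    (B := algDual (fderiv ℝ (momentum fun y => L (natParam e y)) y))
    (dl := (fderiv ℝ (fun y => L (natParam e y)) y).toLinearMap)
    (momentum_fderiv_nondegenerate he hL hreg hy)
    (differential_energy_reeb he hL hreg hy) (fun w => ?_)
  have h1 := DFunLike.congr_fun h (dParam e y w)
  rw [ContinuousLinearMap.comp_apply, tProj_dParam he hy] at h1
  refine Eq.trans ?_ h1
  rw [add_apply, sub_apply, flat, add_apply, smul_apply, smul_apply, smul_eq_mul, smul_eq_mul,
    contrExtDeriv_contactForm_dParam he hL hy, contactForm_dParam he hL hy,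
    contactForm_dParam he hL hy, differential_energy_dParam he hL hy, energy_natParam he hL hy]
  rfl

end PointwiseDynamics

/-! ### From the pointwise equations to vector fields and integral curves. -/

noncomputable section GlobalDynamics

variable {n k : ℕ} {Q : Type*} [TopologicalSpace Q] [ChartedSpace (Coord n) Q]
  {e : OpenPartialHomeomorph Q (Coord n)}

/-- A functional vanishing on the common kernel of finitely many others lies in their span; this is
the source of the multipliers. -/
theorem exists_sum_mul_eq_of_forall_eq_zero {V : Type*} [AddCommGroup V] [Module ℝ V]
    [TopologicalSpace V] {α : V →L[ℝ] ℝ} {φ : Fin k → V →L[ℝ] ℝ}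
    (h : ∀ u, (∀ a, φ a u = 0) → α u = 0) : ∃ μ : Fin k → ℝ, ∀ u, ∑ a, μ a * φ a u = α u := by
  have hspan : α.toLinearMap ∈ Submodule.span ℝ (Set.range fun a => (φ a).toLinearMap) :=
    mem_span_of_iInf_ker_le_ker fun u hu => h u fun a => (Submodule.mem_iInf _).1 hu a
  obtain ⟨μ, hμ⟩ := (Submodule.mem_span_range_iff_exists_fun ℝ).1 hspan
  exact ⟨μ, fun u => by simpa using DFunLike.congr_fun hμ u⟩

theorem exists_natParam_eq (he : e ∈ IsManifold.maximalAtlas 𝓘(ℝ, Coord n) ∞ Q) {p : Phase n Q}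
    (hp : p.1.1 ∈ e.source) : ∃ y : CoordPhase n, y.1.1 ∈ e.target ∧ natParam e y = p :=
  ⟨natChart e p, e.map_source hp, natParam_natChart he hp⟩

variable [IsManifold 𝓘(ℝ, Coord n) ∞ Q]

/-- The expression of a vector field in natural coordinates. -/
def fieldInCoord (e : OpenPartialHomeomorph Q (Coord n)) (X : (p : Phase n Q) → PSpace p)
    (y : CoordPhase n) : CoordPhase n :=
  dChart e (natParam e y) (X (natParam e y))

theorem fieldInCoord_natChart (he : e ∈ IsManifold.maximalAtlas 𝓘(ℝ, Coord n) ∞ Q)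
    (X : (p : Phase n Q) → PSpace p) {p : Phase n Q} (hp : p.1.1 ∈ e.source) :
    fieldInCoord e X (natChart e p) = dChart e p (X p) :=
  congrArg (fun p => (dChart e p (X p) : CoordPhase n)) (natParam_natChart he hp)

theorem contDiffOn_fieldInCoord (he : e ∈ IsManifold.maximalAtlas 𝓘(ℝ, Coord n) ∞ Q)
    {X : (p : Phase n Q) → PSpace p}
    (hX : ContMDiff (phaseModel n) (phaseModel n).tangent ∞
      (fun p => (⟨p, X p⟩ : TangentBundle (phaseModel n) (Phase n Q)))) :
    ContDiffOn ℝ ∞ (fieldInCoord e X) {y | y.1.1 ∈ e.target} := by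
  have hs : IsOpen {p : Phase n Q | p.1.1 ∈ e.source} :=
    e.open_source.preimage continuous_phase_base
  have h1 := (contMDiffOn_natChart he).contMDiffOn_tangentMapWithin
    (m := ∞) (by simp) hs.uniqueMDiffOn
  have h2 := h1.comp (hX.comp_contMDiffOn (contMDiffOn_natParam he))
    (fun y hy => e.map_target hy)
  have h3 := (contMDiff_snd_tangentBundle_modelSpace (n := ∞) (CoordPhase n)
    𝓘(ℝ, CoordPhase n)).comp_contMDiffOn h2
  refine contMDiffOn_iff_contDiffOn.1 (h3.congr fun y hy => ?_)
  exact congrArg (fun A : PSpace (natParam e y : Phase n Q) →L[ℝ] CoordPhase n =>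
    A (X (natParam e y))) (mfderivWithin_of_isOpen hs (e.map_target hy)).symm

theorem coord_equations (he : e ∈ IsManifold.maximalAtlas 𝓘(ℝ, Coord n) ∞ Q)
    {L : Phase n Q → ℝ} (hL : ContMDiff (phaseModel n) 𝓘(ℝ, ℝ) ∞ L)
    (hreg : IsRegularLagrangian L) {X : (p : Phase n Q) → PSpace p} {y : CoordPhase n}
    (hy : y.1.1 ∈ e.target) {α : TSpace n (natParam e y : Phase n Q).1.1 →L[ℝ] ℝ}
    (h : flat L (natParam e y) (X (natParam e y)) -
        differential (phaseModel n) (energy L) (natParam e y) +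
        (energy L (natParam e y) + differential (phaseModel n) (energy L) (natParam e y)
          (reeb L (natParam e y))) • contactForm L (natParam e y) =
      α.comp (tProj (natParam e y))) :
    (fieldInCoord e X y).1.1 = y.1.2 ∧ (fieldInCoord e X y).2 = L (natParam e y) ∧
      ∀ a, α (mfderiv 𝓘(ℝ, Coord n) 𝓘(ℝ, Coord n) e.symm y.1.1 a) =
        -(fderiv ℝ (momentum fun y => L (natParam e y)) y (fieldInCoord e X y) a) +
          fderiv ℝ (fun y => L (natParam e y)) y ((a, 0), 0) +
          fderiv ℝ (fun y => L (natParam e y)) y ((0, 0), 1) *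
            fderiv ℝ (fun y => L (natParam e y)) y ((0, a), 0) := by
  rw [← dParam_dChart he hy (X (natParam e y))] at h
  exact coord_dynamics he hL hreg hy h

/-- `X` satisfies the constrained contact dynamics. -/
def SatisfiesDynamics (D : (q : Q) → Submodule ℝ (TSpace n q)) (L : Phase n Q → ℝ)
    (X : (p : Phase n Q) → PSpace p) : Prop :=
  ∀ p : Phase n Q, flat L p (X p) - differential (phaseModel n) (energy L) p +
    (energy L p + differential (phaseModel n) (energy L) p (reeb L p)) • contactForm L p
      ∈ annLift D p

variable {D : (q : Q) → Submodule ℝ (TSpace n q)} {L : Phase n Q → ℝ}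
  {X : (p : Phase n Q) → PSpace p}

/-- The equation `X_q = v` freed from coordinates. It yields the SODE property and also identifies
the fibre component of an integral curve with the velocity of its base curve. -/
theorem tProj_field (hL : ContMDiff (phaseModel n) 𝓘(ℝ, ℝ) ∞ L) (hreg : IsRegularLagrangian L)
    (hdyn : SatisfiesDynamics D L X) (p : Phase n Q) : tProj p (X p) = p.1.2 := by
  have he := IsManifold.chart_mem_maximalAtlas (I := 𝓘(ℝ, Coord n)) (n := ∞) p.1.1
  obtain ⟨y, hy, hp⟩ := exists_natParam_eq he (mem_chart_source (Coord n) p.1.1)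
  -- The chart has to be detached from `p` before `p` can be replaced by `natParam e y`.
  generalize chartAt (Coord n) p.1.1 = e at he hy hp
  subst hp
  obtain ⟨α, -, hα⟩ := hdyn (natParam e y)
  rw [← dParam_dChart he hy (X (natParam e y)), tProj_dParam he hy]
  exact congrArg (mfderiv 𝓘(ℝ, Coord n) 𝓘(ℝ, Coord n) e.symm y.1.1)
    (coord_equations he hL hreg hy hα).1

theorem isSODE_of_satisfiesDynamics (hL : ContMDiff (phaseModel n) 𝓘(ℝ, ℝ) ∞ L)
    (hreg : IsRegularLagrangian L) (hdyn : SatisfiesDynamics D L X) : IsSODE X := fun p => by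
  rw [vertEndo, ContinuousLinearMap.comp_apply, tProj_field hL hreg hdyn, liouville]

theorem exists_multipliers (hL : ContMDiff (phaseModel n) 𝓘(ℝ, ℝ) ∞ L)
    (hreg : IsRegularLagrangian L) (hdyn : SatisfiesDynamics D L X) {U : Set Q}
    {Φ : Fin k → (q : Q) → TSpace n q →L[ℝ] ℝ} (hΦ : IsConstraintFrame D U Φ) {p : Phase n Q}
    (hp : p.1.1 ∈ U) :
    ∃ lam : Fin k → ℝ, ∀ e ∈ IsManifold.maximalAtlas 𝓘(ℝ, Coord n) ∞ Q, ∀ y : CoordPhase n,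
      y.1.1 ∈ e.target → natParam e y = p → ∀ i,
        fderiv ℝ (momentum fun y => L (natParam e y)) y (fieldInCoord e X y) (basisVec i) =
          partialQ (inCoord L e) i y.1.1 y.1.2 y.2 +
            partialV (inCoord L e) i y.1.1 y.1.2 y.2 * partialZ (inCoord L e) y.1.1 y.1.2 y.2 +
            ∑ a, lam a * formCoeff (Φ a) e i y.1.1 := by
  obtain ⟨α, hα0, hα⟩ := hdyn p
  obtain ⟨μ, hμ⟩ := exists_sum_mul_eq_of_forall_eq_zero (α := α) (φ := fun a => Φ a p.1.1)
    fun u hu => hα0 u ((hΦ.mem_iff _ hp u).2 hu)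
  -- The momentum derivative enters `α` with a minus sign. The `μ` were chosen from `α` at `p`
  -- before any chart, so they serve all charts.
  refine ⟨fun a => -μ a, ?_⟩
  rintro e he y hy rfl i
  have hl := differentiableAt_natParam_comp he hL hy
  have h1 := (coord_equations he hL hreg hy hα).2.2 (basisVec i)
  have h2 : ∑ a, μ a * formCoeff (Φ a) e i y.1.1 =
      α (mfderiv 𝓘(ℝ, Coord n) 𝓘(ℝ, Coord n) e.symm y.1.1 (basisVec i)) := hμ _
  rw [partialQ_eq hl, partialV_eq hl, partialZ_eq hl, momentum_apply]
  simp only [neg_mul, Finset.sum_neg_distrib]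
  rw [h2, h1]
  ring

section Curves

variable {γ : ℝ → Phase n Q} {s : Set ℝ}

theorem hasDerivAt_natChart_comp (he : e ∈ IsManifold.maximalAtlas 𝓘(ℝ, Coord n) ∞ Q) {t : ℝ}
    {w : PSpace (γ t)}
    (hγ : HasMFDerivAt 𝓘(ℝ, ℝ) (phaseModel n) γ t ((1 : ℝ →L[ℝ] ℝ).smulRight w))
    (ht : (γ t).1.1 ∈ e.source) :
    HasDerivAt (fun τ => natChart e (γ τ)) (dChart e (γ t) w) t := by
  have h1 : HasFDerivAt (fun τ => natChart e (γ τ))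
      ((dChart e (γ t)).comp ((1 : ℝ →L[ℝ] ℝ).smulRight w) : ℝ →L[ℝ] CoordPhase n) t :=
    ((mdifferentiableAt_natChart he ht).hasMFDerivAt.comp t hγ).hasFDerivAt
  exact h1.hasDerivAt.congr_deriv
    (congrArg (fun v : PSpace (γ t) => dChart e (γ t) v) (one_smul ℝ w))

theorem hasDerivAt_base {c : ℝ → CoordPhase n} {c' : CoordPhase n} {t : ℝ}
    (h : HasDerivAt c c' t) : HasDerivAt (fun τ => (c τ).1.1) c'.1.1 t :=
  h.fst.fst

theorem hasDerivAt_action {c : ℝ → CoordPhase n} {c' : CoordPhase n} {t : ℝ}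
    (h : HasDerivAt c c' t) : HasDerivAt (fun τ => (c τ).2) c'.2 t :=
  h.snd

theorem hasDerivAt_momentum {l : CoordPhase n → ℝ} {c : ℝ → CoordPhase n} {c' : CoordPhase n}
    {t : ℝ} (hl : DifferentiableAt ℝ (momentum l) (c t)) (h : HasDerivAt c c' t) (a : Coord n) :
    HasDerivAt (fun τ => momentum l (c τ) a) (fderiv ℝ (momentum l) (c t) c' a) t := by
  simpa using (hl.hasFDerivAt.comp_hasDerivAt t h).clm_apply (hasDerivAt_const t a)

theorem isOpen_curve_preimage (hs : IsOpen s) (hγ : ContinuousOn γ s) {U : Set Q}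
    (hU : IsOpen U) : IsOpen (s ∩ {t | (γ t).1.1 ∈ U}) :=
  (continuous_phase_base.comp_continuousOn hγ).isOpen_inter_preimage hs hU

/-- Near each time the curve solves a smooth autonomous equation in natural coordinates, so the
bootstrap applies. -/
theorem contMDiffOn_integralCurve
    (hX : ContMDiff (phaseModel n) (phaseModel n).tangent ∞
      (fun p => (⟨p, X p⟩ : TangentBundle (phaseModel n) (Phase n Q))))
    (hs : IsOpen s) (hγ : IsMIntegralCurveOn γ X s) :
    ContMDiffOn 𝓘(ℝ, ℝ) (phaseModel n) ∞ γ s := by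
  intro t₀ ht₀
  have he := IsManifold.chart_mem_maximalAtlas (I := 𝓘(ℝ, Coord n)) (n := ∞) (γ t₀).1.1
  set e := chartAt (Coord n) (γ t₀).1.1 with hedef
  have hs' := isOpen_curve_preimage hs hγ.continuousOn e.open_source
  have hmem : t₀ ∈ s ∩ {t | (γ t).1.1 ∈ e.source} := ⟨ht₀, mem_chart_source _ _⟩
  have hc : ContDiffOn ℝ ∞ (fun τ => natChart e (γ τ)) (s ∩ {t | (γ t).1.1 ∈ e.source}) := by
    refine contDiffOn_of_hasDerivAt_comp (contDiffOn_fieldInCoord he hX) hs'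
      (fun t ht => e.map_source ht.2) fun t ht => ?_
    rw [fieldInCoord_natChart he X ht.2]
    exact hasDerivAt_natChart_comp he ((hγ t ht.1).hasMFDerivAt (hs.mem_nhds ht.1)) ht.2
  have h1 := (contMDiffOn_natParam he).comp hc.contMDiffOn (fun t ht => e.map_source ht.2)
  have h2 : ContMDiffOn 𝓘(ℝ, ℝ) (phaseModel n) ∞ γ (s ∩ {t | (γ t).1.1 ∈ e.source}) :=
    h1.congr fun t ht => (natParam_natChart he ht.2).symm
  exact (h2.contMDiffAt (hs'.mem_nhds hmem)).contMDiffWithinAt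

theorem velocity_integralCurve (hL : ContMDiff (phaseModel n) 𝓘(ℝ, ℝ) ∞ L)
    (hreg : IsRegularLagrangian L) (hdyn : SatisfiesDynamics D L X)
    (hs : IsOpen s) (hγ : IsMIntegralCurveOn γ X s) {t : ℝ} (ht : t ∈ s) :
    velocity 𝓘(ℝ, Coord n) (fun r => (γ r).1.1) t = (γ t).1.2 := by
  have h1 := ((contMDiff_phase_base (n := n) (Q := Q)).mdifferentiableAt
    (x := γ t) (by simp)).hasMFDerivAt
  have h2 := (h1.comp t ((hγ t ht).hasMFDerivAt (hs.mem_nhds ht))).mfderiv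
  refine (DFunLike.congr_fun h2 (1 : ℝ)).trans ?_
  refine Eq.trans ?_ (tProj_field hL hreg hdyn (γ t))
  exact congrArg (tProj (γ t)) (one_smul ℝ (X (γ t)))

theorem tangentLift_integralCurve (hL : ContMDiff (phaseModel n) 𝓘(ℝ, ℝ) ∞ L)
    (hreg : IsRegularLagrangian L) (hdyn : SatisfiesDynamics D L X)
    (hs : IsOpen s) (hγ : IsMIntegralCurveOn γ X s) {t : ℝ} (ht : t ∈ s) :
    (γ t).1 = tangentLift (fun r => (γ r).1.1) t :=
  Bundle.TotalSpace.ext rfl (heq_of_eq (velocity_integralCurve hL hreg hdyn hs hγ ht).symm)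

open Topology in
theorem solvesMultiplierEquations_integralCurve (hL : ContMDiff (phaseModel n) 𝓘(ℝ, ℝ) ∞ L)
    (hreg : IsRegularLagrangian L)
    (hX : ContMDiff (phaseModel n) (phaseModel n).tangent ∞
      (fun p => (⟨p, X p⟩ : TangentBundle (phaseModel n) (Phase n Q))))
    (hdyn : SatisfiesDynamics D L X) (hs : IsOpen s) (hγ : IsMIntegralCurveOn γ X s) :
    SolvesMultiplierEquations k L D s (fun r => (γ r).1.1) (fun r => (γ r).2) := by
  have hsmooth := contMDiffOn_integralCurve hX hs hγ
  have hcoord : ∀ e ∈ IsManifold.maximalAtlas 𝓘(ℝ, Coord n) ∞ Q, ∀ t ∈ s,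
      (γ t).1.1 ∈ e.source → HasDerivAt (fun τ => natChart e (γ τ))
        (fieldInCoord e X (natChart e (γ t))) t := fun e he t ht hte => by
    rw [fieldInCoord_natChart he X hte]
    exact hasDerivAt_natChart_comp he ((hγ t ht).hasMFDerivAt (hs.mem_nhds ht)) hte
  have heqs : ∀ e ∈ IsManifold.maximalAtlas 𝓘(ℝ, Coord n) ∞ Q, ∀ t ∈ s,
      (γ t).1.1 ∈ e.source →
        (fieldInCoord e X (natChart e (γ t))).1.1 = (natChart e (γ t)).1.2 ∧
        (fieldInCoord e X (natChart e (γ t))).2 = L (γ t) := fun e he t ht hte => by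
    obtain ⟨α, -, hα⟩ := hdyn (natParam e (natChart e (γ t)))
    have := coord_equations he hL hreg (e.map_source hte) hα
    exact ⟨this.1, this.2.1.trans (by rw [natParam_natChart he hte])⟩
  refine ⟨?_, ?_, fun t ht => ?_, fun U Φ hΦ => ?_⟩
  · exact contMDiff_phase_base.comp_contMDiffOn hsmooth
  · exact contMDiffOn_iff_contDiffOn.1 (contMDiff_snd.comp_contMDiffOn hsmooth)
  · have he := IsManifold.chart_mem_maximalAtlas (I := 𝓘(ℝ, Coord n)) (n := ∞) (γ t).1.1
    have hte := mem_chart_source (Coord n) (γ t).1.1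
    have h1 := hasDerivAt_action (hcoord _ he t ht hte)
    refine h1.congr_deriv ((heqs _ he t ht hte).2.trans ?_)
    rw [← tangentLift_integralCurve hL hreg hdyn hs hγ ht]
  -- Multipliers are chosen as functions of the phase point and then evaluated along the curve.
  · choose! lam hlam using fun (p : Phase n Q) (hp : p.1.1 ∈ U) =>
      exists_multipliers hL hreg hdyn hΦ hp
    refine ⟨fun a t => lam (γ t) a, fun e he t ht htU hte i => ?_⟩
    have hs' := isOpen_curve_preimage hs hγ.continuousOn e.open_source
    have hderiv : ∀ τ ∈ s ∩ {t | (γ t).1.1 ∈ e.source},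
        deriv (fun r => e (γ r).1.1) τ = (natChart e (γ τ)).1.2 := fun τ hτ => by
      exact (hasDerivAt_base (hcoord e he τ hτ.1 hτ.2)).deriv.trans (heqs e he τ hτ.1 hτ.2).1
    have htmem : t ∈ s ∩ {t | (γ t).1.1 ∈ e.source} := ⟨ht, hte⟩
    have hy : (natChart e (γ t)).1.1 ∈ e.target := e.map_source hte
    have hm := differentiableAt_momentum e.open_target (contDiffOn_natParam_comp he hL) hy
    have h2 := hasDerivAt_momentum (c := fun τ => natChart e (γ τ)) hm (hcoord e he t ht hte)
      (basisVec i)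
    rw [hderiv t htmem]
    refine (h2.congr_of_eventuallyEq ?_).congr_deriv
      (hlam (γ t) htU e he _ hy (natParam_natChart he hte) i)
    -- Near `t` the velocity in the chart is the `v`-coordinate of `γ`, so the function to
    -- differentiate is a component of the momentum along `γ`.
    filter_upwards [hs'.mem_nhds htmem] with τ hτ
    rw [hderiv τ hτ]
    exact partialV_eq (y := natChart e (γ τ))
      (differentiableAt_natParam_comp he hL (e.map_source hτ.2)) i

end Curves

end GlobalDynamics

/-! ### Integral curves that meet `Δ × ℝ` stay in it. -/

noncomputable section Invariance

/-- If the joint map `V → ℝᵏ` were not onto, a nonzero functional vanishing on its range would be a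
linear relation among the `φ a`. -/
theorem exists_rightInverse_of_linearIndependent {k : ℕ} {V : Type*} [AddCommGroup V] [Module ℝ V]
    [TopologicalSpace V] [IsTopologicalAddGroup V] [ContinuousSMul ℝ V]
    {φ : Fin k → V →L[ℝ] ℝ} (h : LinearIndependent ℝ φ) :
    ∃ A : (Fin k → ℝ) →L[ℝ] V, ∀ w a, φ a (A w) = w a := by
  let T : V →ₗ[ℝ] Fin k → ℝ := LinearMap.pi fun a => (φ a).toLinearMap
  have hT : LinearMap.range T = ⊤ := by
    by_contra hne
    obtain ⟨f, hf0, hf⟩ := Submodule.exists_le_ker_of_lt_top _ (lt_top_iff_ne_top.2 hne)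
    have hfw := LinearMap.pi_apply_eq_sum_univ f
    have hz : ∑ a, f (fun j => if a = j then 1 else 0) • φ a = 0 := by
      ext u
      have : f (T u) = 0 := hf ⟨u, rfl⟩
      rw [hfw] at this
      simpa [T, mul_comm] using this
    have hc := Fintype.linearIndependent_iff.1 h _ hz
    exact hf0 (LinearMap.ext fun w => by rw [hfw]; simp [hc])
  obtain ⟨A, hA⟩ := T.exists_rightInverse_of_surjective hT
  exact ⟨A.toContinuousLinearMap, fun w a => congrFun (DFunLike.congr_fun hA w) a⟩

theorem eq_smulRight_apply_one {V : Type*} [AddCommGroup V] [Module ℝ V] [TopologicalSpace V]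
    [ContinuousSMul ℝ V] (A : ℝ →L[ℝ] V) : A = (1 : ℝ →L[ℝ] ℝ).smulRight (A 1) := by
  ext
  simp

variable {n k : ℕ} {Q : Type*} [TopologicalSpace Q] [ChartedSpace (Coord n) Q]
  {e : OpenPartialHomeomorph Q (Coord n)}
  {D : (q : Q) → Submodule ℝ (TSpace n q)} {U : Set Q}
  {Φ : Fin k → (q : Q) → TSpace n q →L[ℝ] ℝ}

/-- The constraint functions `Φᵃ(q̇)` in natural coordinates. -/
def constraintInCoord (e : OpenPartialHomeomorph Q (Coord n))
    (Φ : Fin k → (q : Q) → TSpace n q →L[ℝ] ℝ) (y : CoordPhase n) : Fin k → ℝ :=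
  fun a => Φ a (natParam e y).1.1 (natParam e y).1.2

/-- The part of the domain of a chart lying in `U`, in coordinates. -/
def coordDomain (e : OpenPartialHomeomorph Q (Coord n)) (U : Set Q) : Set (Coord n) :=
  e.target ∩ e.symm ⁻¹' U

theorem isOpen_coordDomain {Q : Type*} [TopologicalSpace Q]
    {e : OpenPartialHomeomorph Q (Coord n)} {U : Set Q} (hU : IsOpen U) : IsOpen (coordDomain e U) :=
  e.isOpen_inter_preimage_symm hU

theorem natChart_mem_coordDomain {p : Phase n Q} (hp : p.1.1 ∈ e.source) (hU : p.1.1 ∈ U) :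
    (natChart e p).1.1 ∈ coordDomain e U :=
  ⟨e.map_source hp, by
    have h : e.symm (e p.1.1) ∈ U := by rwa [e.left_inv hp]
    exact h⟩

theorem constraintInCoord_linear (x : Coord n) : ∃ A : Coord n →ₗ[ℝ] Fin k → ℝ,
    ∀ v z, constraintInCoord e Φ ((x, v), z) = A v :=
  ⟨LinearMap.pi fun a => ((Φ a (e.symm x)).comp
    (mfderiv 𝓘(ℝ, Coord n) 𝓘(ℝ, Coord n) e.symm x)).toLinearMap, fun _ _ => rfl⟩

variable [IsManifold 𝓘(ℝ, Coord n) ∞ Q]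

theorem constraintInCoord_eq_zero_iff (hΦ : IsConstraintFrame D U Φ) {y : CoordPhase n}
    (hy : y.1.1 ∈ coordDomain e U) :
    constraintInCoord e Φ y = 0 ↔ natParam e y ∈ constraintSet D :=
  funext_iff.trans (hΦ.mem_iff _ hy.2 _).symm

theorem constraintInCoord_natChart_eq_zero_iff
    (he : e ∈ IsManifold.maximalAtlas 𝓘(ℝ, Coord n) ∞ Q) (hΦ : IsConstraintFrame D U Φ)
    {p : Phase n Q} (hp : p.1.1 ∈ e.source) (hU : p.1.1 ∈ U) :
    constraintInCoord e Φ (natChart e p) = 0 ↔ p ∈ constraintSet D := by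
  rw [constraintInCoord_eq_zero_iff hΦ (natChart_mem_coordDomain hp hU), natParam_natChart he hp]

theorem contDiffOn_constraintInCoord (he : e ∈ IsManifold.maximalAtlas 𝓘(ℝ, Coord n) ∞ Q)
    (hΦ : IsConstraintFrame D U Φ) :
    ContDiffOn ℝ ∞ (constraintInCoord e Φ) {y | y.1.1 ∈ coordDomain e U} := by
  refine contDiffOn_pi.2 fun a => contMDiffOn_iff_contDiffOn.1 ?_
  have h1 : ContMDiffOn 𝓘(ℝ, CoordPhase n) 𝓘(ℝ, Coord n).tangent ∞
      (fun y : CoordPhase n => (natParam e y : Phase n Q).1) {y | y.1.1 ∈ coordDomain e U} :=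
    contMDiff_fst.comp_contMDiffOn ((contMDiffOn_natParam he).mono fun y hy => hy.1)
  exact (hΦ.smooth a).comp h1 fun y hy => hy.2

theorem exists_rightInverse_constraintInCoord
    (he : e ∈ IsManifold.maximalAtlas 𝓘(ℝ, Coord n) ∞ Q) (hΦ : IsConstraintFrame D U Φ)
    {x : Coord n} (hx : x ∈ coordDomain e U) : ∃ A : (Fin k → ℝ) →L[ℝ] Coord n,
      ∀ w z, constraintInCoord e Φ ((x, A w), z) = w := by
  obtain ⟨A, hA⟩ := exists_rightInverse_of_linearIndependent (hΦ.independent _ hx.2)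
  have hxs := e.map_target hx.1
  have h := (mdifferentiable_of_mem_maximalAtlas he).symm_comp_deriv hxs
  rw [e.right_inv hx.1] at h
  let T : TSpace n (e.symm x) →L[ℝ] Coord n := mfderiv 𝓘(ℝ, Coord n) 𝓘(ℝ, Coord n) e (e.symm x)
  refine ⟨T.comp A, fun w z => funext fun a => ?_⟩
  exact (congrArg (Φ a (e.symm x)) (DFunLike.congr_fun h (A w))).trans (hA w a)

-- Tangency provides a curve inside `Δ × ℝ` with velocity `X`; the constraint functions are zero
-- along it, and so is their derivative.
open Topology in
theorem fderiv_constraintInCoord_field (he : e ∈ IsManifold.maximalAtlas 𝓘(ℝ, Coord n) ∞ Q)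
    (hΦ : IsConstraintFrame D U Φ) {X : (p : Phase n Q) → PSpace p}
    (htan : ∀ p ∈ constraintSet D, IsTangentTo (phaseModel n) (constraintSet D) p (X p))
    {y : CoordPhase n} (hy : y.1.1 ∈ coordDomain e U) (h0 : constraintInCoord e Φ y = 0) :
    fderiv ℝ (constraintInCoord e Φ) y (fieldInCoord e X y) = 0 := by
  obtain ⟨c, hc, hcD, heq⟩ := htan _ ((constraintInCoord_eq_zero_iff hΦ hy).1 h0)
  have hc0 : c 0 = natParam e y := congrArg Bundle.TotalSpace.proj heq
  have hvel : dChart e (c 0) (velocity (phaseModel n) c 0) = fieldInCoord e X y :=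
    congrArg (fun v : TangentBundle (phaseModel n) (Phase n Q) => (dChart e v.1 v.2 : CoordPhase n))
      heq
  have hs : (c 0).1.1 ∈ e.source := by rw [hc0]; exact e.map_target hy.1
  have hU : (c 0).1.1 ∈ U := by rw [hc0]; exact hy.2
  have hchart : natChart e (c 0) = y := by rw [hc0, natChart_natParam he hy.1]
  have hcm : HasMFDerivAt 𝓘(ℝ, ℝ) (phaseModel n) c 0
      ((1 : ℝ →L[ℝ] ℝ).smulRight (velocity (phaseModel n) c 0)) := 
    (hc.mdifferentiableAt (by simp)).hasMFDerivAt.congr_mfderiv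
      (eq_smulRight_apply_one (V := PSpace (c 0)) _)
  have h1 := hasDerivAt_natChart_comp he hcm hs
  rw [hvel] at h1
  have h2 : HasFDerivAt (constraintInCoord e Φ) (fderiv ℝ (constraintInCoord e Φ) y)
      (natChart e (c 0)) := by
    rw [hchart]
    exact (((contDiffOn_constraintInCoord he hΦ).contDiffAt
      ((isOpen_coord_source _ (isOpen_coordDomain hΦ.isOpen)).mem_nhds hy)).differentiableAt
        (by simp)).hasFDerivAt
  have h3 := HasFDerivAt.comp_hasDerivAt (f := fun τ => natChart e (c τ)) 0 h2 h1
  refine h3.unique ((hasDerivAt_const (0 : ℝ) (0 : Fin k → ℝ)).congr_of_eventuallyEq ?_)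
  have hcont : ContinuousAt (fun t => (c t).1.1) 0 :=
    continuous_phase_base.continuousAt.comp hc.continuousAt
  filter_upwards [hcD, hcont (e.open_source.mem_nhds hs), hcont (hΦ.isOpen.mem_nhds hU)]
    with t h4 h5 h6
  exact (constraintInCoord_natChart_eq_zero_iff he hΦ h5 h6).2 h4

variable {X : (p : Phase n Q) → PSpace p} {γ : ℝ → Phase n Q} {s : Set ℝ}

open Topology in
theorem eventually_mem_constraintSet (hD : IsRegularDistribution k D)
    (hX : ContMDiff (phaseModel n) (phaseModel n).tangent ∞
      (fun p => (⟨p, X p⟩ : TangentBundle (phaseModel n) (Phase n Q))))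
    (htan : ∀ p ∈ constraintSet D, IsTangentTo (phaseModel n) (constraintSet D) p (X p))
    (hs : IsOpen s) (hγ : IsMIntegralCurveOn γ X s) {t₀ : ℝ} (ht₀ : t₀ ∈ s)
    (hmem : γ t₀ ∈ constraintSet D) : ∀ᶠ t in 𝓝 t₀, γ t ∈ constraintSet D := by
  obtain ⟨U, Φ, hqU, hΦ⟩ := hD (γ t₀).1.1
  have he := IsManifold.chart_mem_maximalAtlas (I := 𝓘(ℝ, Coord n)) (n := ∞) (γ t₀).1.1
  have hqe := mem_chart_source (Coord n) (γ t₀).1.1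
  set e := chartAt (Coord n) (γ t₀).1.1 with hedef
  have hse := (isOpen_curve_preimage hs hγ.continuousOn e.open_source).mem_nhds ⟨ht₀, hqe⟩
  have hsU := (isOpen_curve_preimage hs hγ.continuousOn hΦ.isOpen).mem_nhds ⟨ht₀, hqU⟩
  have key := eventually_constraint_eq_zero (c := fun t => natChart e (γ t)) (t₀ := t₀)
    (isOpen_coordDomain hΦ.isOpen) (contDiffOn_constraintInCoord he hΦ)
    (fun x _ => constraintInCoord_linear x)
    ((contDiffOn_fieldInCoord he hX).mono fun y hy => hy.1)
    (fun y hy h0 => fderiv_constraintInCoord_field he hΦ htan hy h0)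
    (by
      filter_upwards [hse] with t ht
      rw [fieldInCoord_natChart he X ht.2]
      exact hasDerivAt_natChart_comp he ((hγ t ht.1).hasMFDerivAt (hs.mem_nhds ht.1)) ht.2)
    (natChart_mem_coordDomain hqe hqU)
    (exists_rightInverse_constraintInCoord he hΦ (natChart_mem_coordDomain hqe hqU))
    ((constraintInCoord_natChart_eq_zero_iff he hΦ hqe hqU).2 hmem)
  filter_upwards [key, hse, hsU] with t h1 h2 h3
  exact (constraintInCoord_natChart_eq_zero_iff he hΦ h2.2 h3.2).1 h1

-- Relative closedness: near `t₀` membership is the vanishing of a function of time that is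
-- continuous at `t₀`.
open Topology in
theorem mem_constraintSet_of_mem_closure (hD : IsRegularDistribution k D)
    (hs : IsOpen s) (hγ : ContinuousOn γ s) {t₀ : ℝ} (ht₀ : t₀ ∈ s)
    (hcl : t₀ ∈ closure {t | γ t ∈ constraintSet D}) : γ t₀ ∈ constraintSet D := by
  obtain ⟨U, Φ, hqU, hΦ⟩ := hD (γ t₀).1.1
  have he := IsManifold.chart_mem_maximalAtlas (I := 𝓘(ℝ, Coord n)) (n := ∞) (γ t₀).1.1
  have hqe := mem_chart_source (Coord n) (γ t₀).1.1
  set e := chartAt (Coord n) (γ t₀).1.1 with hedef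
  have hse := (isOpen_curve_preimage hs hγ e.open_source).mem_nhds ⟨ht₀, hqe⟩
  have hsU := (isOpen_curve_preimage hs hγ hΦ.isOpen).mem_nhds ⟨ht₀, hqU⟩
  have hcont : ContinuousAt (fun t => constraintInCoord e Φ (natChart e (γ t))) t₀ := by
    have h1 : ContinuousAt (constraintInCoord e Φ) (natChart e (γ t₀)) :=
      ((contDiffOn_constraintInCoord he hΦ).contDiffAt
        ((isOpen_coord_source _ (isOpen_coordDomain hΦ.isOpen)).mem_nhds
          (natChart_mem_coordDomain hqe hqU))).continuousAt
    exact ContinuousAt.comp (f := fun t => natChart e (γ t)) h1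
      ((contMDiffAt_natChart he hqe).continuousAt.comp (hγ.continuousAt (hs.mem_nhds ht₀)))
  refine (constraintInCoord_natChart_eq_zero_iff he hΦ hqe hqU).1 ?_
  by_contra hne
  have hev := hcont.eventually_ne hne
  obtain ⟨t, ⟨h1, h2, h3⟩, h4⟩ := mem_closure_iff_nhds.1 hcl _
    (Filter.inter_mem hev (Filter.inter_mem hse hsU))
  exact h1 ((constraintInCoord_natChart_eq_zero_iff he hΦ h2.2 h3.2).2 h4)

/-- An integral curve of a vector field tangent to `Δ × ℝ` which meets it stays in it. -/
theorem integralCurve_mem_constraintSet (hD : IsRegularDistribution k D)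
    (hX : ContMDiff (phaseModel n) (phaseModel n).tangent ∞
      (fun p => (⟨p, X p⟩ : TangentBundle (phaseModel n) (Phase n Q))))
    (htan : ∀ p ∈ constraintSet D, IsTangentTo (phaseModel n) (constraintSet D) p (X p))
    (hs : IsOpen s) (hconn : s.OrdConnected) (hγ : IsMIntegralCurveOn γ X s)
    (hmeet : ∃ t ∈ s, γ t ∈ constraintSet D) : ∀ t ∈ s, γ t ∈ constraintSet D := by
  have hopen : IsOpen {t | t ∈ s ∧ γ t ∈ constraintSet D} := isOpen_iff_mem_nhds.2 fun t ht =>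
    (hs.eventually_mem ht.1).and (eventually_mem_constraintSet hD hX htan hs hγ ht.1 ht.2)
  obtain ⟨t₀, h1, h2⟩ := hmeet
  -- An interval is connected, so a nonempty open and relatively closed set of times fills it.
  have hsub := hconn.isPreconnected.subset_of_closure_inter_subset hopen ⟨t₀, h1, h1, h2⟩
    fun t ht => ⟨ht.2, mem_constraintSet_of_mem_closure hD hs hγ.continuousOn ht.2
      (closure_mono (fun _ h => h.2) ht.1)⟩
  exact fun t ht => (hsub ht).2

end Invariance

theorem theorem18 {n k : ℕ} {Q : Type*} [TopologicalSpace Q] [ChartedSpace (Coord n) Q]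
    [IsManifold 𝓘(ℝ, Coord n) ∞ Q]
    (D : (q : Q) → Submodule ℝ (TSpace n q)) (hD : IsRegularDistribution k D)
    (L : Phase n Q → ℝ) (hL : ContMDiff (phaseModel n) 𝓘(ℝ, ℝ) ∞ L)
    (hreg : IsRegularLagrangian L)
    (X : (p : Phase n Q) → PSpace p)
    (hX : ContMDiff (phaseModel n) (phaseModel n).tangent ∞
      (fun p => (⟨p, X p⟩ : TangentBundle (phaseModel n) (Phase n Q))))
    (hdyn : ∀ p : Phase n Q,
      flat L p (X p) - differential (phaseModel n) (energy L) p +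
        (energy L p + differential (phaseModel n) (energy L) p (reeb L p)) • contactForm L p
        ∈ annLift D p)
    (htan : ∀ p ∈ constraintSet D, IsTangentTo (phaseModel n) (constraintSet D) p (X p)) :
    IsSODE X ∧
    ∀ (γ : ℝ → Phase n Q) (s : Set ℝ), IsOpen s → s.OrdConnected → IsMIntegralCurveOn γ X s →
      (∀ t ∈ s, (γ t).1 = tangentLift (fun r => (γ r).1.1) t) ∧
      SolvesMultiplierEquations k L D s (fun r => (γ r).1.1) (fun r => (γ r).2) ∧
      ((∃ t ∈ s, γ t ∈ constraintSet D) →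
        SolvesConstrainedHerglotz k L D s (fun r => (γ r).1.1) (fun r => (γ r).2) ∧
        ∀ t ∈ s, γ t ∈ constraintSet D) := by
  refine ⟨isSODE_of_satisfiesDynamics hL hreg hdyn, fun γ s hs hconn hγ => ?_⟩
  have hmult : SolvesMultiplierEquations k L D s (fun r => (γ r).1.1) (fun r => (γ r).2) :=
    solvesMultiplierEquations_integralCurve hL hreg hX hdyn hs hγ
  refine ⟨fun t ht => tangentLift_integralCurve hL hreg hdyn hs hγ ht, hmult, fun hmeet => ?_⟩
  have hmem := integralCurve_mem_constraintSet hD hX htan hs hconn hγ hmeet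
  refine ⟨⟨hmult, fun U Φ hΦ t ht htU a => ?_⟩, hmem⟩
  rw [velocity_integralCurve hL hreg hdyn hs hγ ht]
  exact (hΦ.mem_iff _ htU _).1 (hmem t ht) a
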